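/- Let $K:[0,1]\times[0,1]\to\mathbb R$ be given by $K(x,y)=\frac12-\{1/(xy)\}$ for $0<x,y\le 1$ (where $\{\alpha\}=\alpha-\lfloor\alpha\rfloor$) and $K(x,y)=0$ if $xy=0$. Let $L^2([0,1])$ be the space of real-valued Lebesgue measurable square-integrable functions on $[0,1]$, with $\langle f,g\rangle=\int_0^1 f(x)g(x)\,dx$. An eigenfunction of $K$ with eigenvalue $\mu\in\mathbb R$ is a function $\psi\in L^2([0,1])$ with $\langle\psi,\psi\rangle>0$ and $\psi(x)=\mu\int_0^1K(x,y)\psi(y)\,dy$ for all $x\in[0,1]$ (so that $\mu\neq0$). Let $\phi_1,\phi_2,\phi_3,\ldots$ be a maximal orthonormal system of eigenfunctions of $K$, with eigenvalues $\lambda_1,\lambda_2,\lambda_3,\ldots$ respectively; here maximal means that no eigenfunction of $K$ is orthogonal to every $\phi_h$. Fix $j\in\mathbb N$ and write $\phi=\phi_j$, $\lambda=\lambda_j$. Then $\phi$ is differentiable almost everywhere in $[0,1]$, and the functions $$Q(x)=x\phi'(x)\ \text{ (for those } x\in[0,1] \text{ at which } \phi'(x) \text{ exists)},\qquad P(x)=-\lambda\int_0^1K(x,y)Q(y)\,dy\quad(0\le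 x\le1)$$ are measurable and square-integrable on $[0,1]$. Put $a_h=\langle P,\phi_h\rangle$ and $b_h=\langle Q,\phi_h\rangle$ for $h\in\mathbb N$. Then the series $\sum_h a_h\phi_h$ and $\sum_h b_h\phi_h$ converge in the mean to $P$ and $Q$ respectively: $$\lim_{H\to\infty}\int_0^1\Bigl(P(x)-\sum_{h=1}^Ha_h\phi_h(x)\Bigr)^2dx=0,\qquad \lim_{H\to\infty}\int_0^1\Bigl(Q(x)-\sum_{h=1}^Hb_h\phi_h(x)\Bigr)^2dx=0.$$ Moreover, for every $h\in\mathbb N$, $$-\frac{\lambda_h}{\lambda}\Bigl(1+\frac{\lambda_h}{\lambda}\Bigr)a_h=\Bigl(1+\frac{\lambda_h}{\lambda}\Bigr)b_h=\phi(1)\phi_h(1)-\langle\phi,\phi_h\rangle .$$ -/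

import Mathlib

open MeasureTheory Set Filter Topology

noncomputable section

namespace MertensKernel

/-- The kernel `K(x,y) = 1/2 - {1/(xy)}` for `0 < x, y ≤ 1`, and `K(x,y) = 0` for `xy = 0`.
Only its values on `[0,1] × [0,1]` matter. -/
def K (x y : ℝ) : ℝ :=
  if 0 < x ∧ 0 < y then 1 / 2 - Int.fract ((x * y)⁻¹) else 0

/-- Lebesgue measure on `[0,1]`. -/
abbrev unitMeasure : Measure ℝ := volume.restrict (Icc (0 : ℝ) 1)

/-- The inner product `⟨f, g⟩ = ∫₀¹ f(x) g(x) dx`. -/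
def ip (f g : ℝ → ℝ) : ℝ := ∫ x in (0 : ℝ)..1, f x * g x

/-- `ψ` is an eigenfunction of `K` with eigenvalue `μ`: it is square-integrable on `[0,1]`,
has positive norm, and `ψ(x) = μ ∫₀¹ K(x,y) ψ(y) dy` at every point `x` of `[0,1]`.
Functions on `[0,1]` are represented by functions on `ℝ` whose values off `[0,1]` are ignored.
The positivity of the norm forces `μ ≠ 0`. -/
structure IsEigenfunction (ψ : ℝ → ℝ) (μ : ℝ) : Prop where
  memLp : MemLp ψ 2 unitMeasure
  norm_pos : 0 < ip ψ ψ
  eq : ∀ x ∈ Icc (0 : ℝ) 1, ψ x = μ * ∫ y in (0 : ℝ)..1, K x y * ψ y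

/-- `(φ h)` is a maximal orthonormal system of eigenfunctions of `K`, with eigenvalues `(ev h)`.
The sequence is indexed from `0`. -/
structure IsMaximalEigensystem (φ : ℕ → ℝ → ℝ) (ev : ℕ → ℝ) : Prop where
  eigen : ∀ h, IsEigenfunction (φ h) (ev h)
  orthonormal : ∀ h k, ip (φ h) (φ k) = if h = k then 1 else 0
  /-- No eigenfunction is orthogonal to every member of the system. -/
  maximal : ¬ ∃ (ψ : ℝ → ℝ) (μ : ℝ), IsEigenfunction ψ μ ∧ ∀ h, ip ψ (φ h) = 0

/-- `Q(x) = x f'(x)`, where `f'` is the derivative of `f` as a function on `[0,1]` (hence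
one-sided at the end points); the value is `0` at points where `f'` does not exist. -/
def Q (f : ℝ → ℝ) (x : ℝ) : ℝ := x * derivWithin f (Icc 0 1) x

/-- `P(x) = -μ ∫₀¹ K(x,y) Q(y) dy`, for an eigenfunction `f` with eigenvalue `μ`. -/
def P (f : ℝ → ℝ) (μ : ℝ) (x : ℝ) : ℝ := -μ * ∫ y in (0 : ℝ)..1, K x y * Q f y

end MertensKernel

end

/-!
Write `T f(x) = ∫₀¹ K(x,y) f(y) dy`, so that `φ = λ T φ`. Formally, differentiating the eigenvalue
equation along dilations gives `Q = λ φ(1) K(·,1) - φ + P` with `P = -λ T Q`; pairing this with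
`φ_h` and using the symmetry of `T` yields the relations between `a_h`, `b_h` and
`φ(1) φ_h(1)`. Two things have to be justified: that `φ` is regular enough for this, and that `P`
and `Q` lie in the closed span of the eigenfunctions.

Regularity rests on the oscillation of the kernel. If the primitive of `f` is `O(B t²)` at `0`, then
`∫₀^δ K(x,y) f(y) dy = O(B δ / x)` (`abs_integral_K_mul_le`). With `f = K(x,·)` this bounds the
iterated kernel by `2x/z`, whence `φ(x) = O(x)` (`IsEigenfunction.exists_linear_bound`). With
`f = φ(s·) - φ`, a difference which the eigenvalue equation reproduces up to terms of order `1 - s`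
(`IsEigenfunction.sub_comp_mul_eq`), it shows `φ(sx) - φ(x) = O((1 - s) x^(-1/4))`
(`IsEigenfunction.exists_dilation_bound`). Hence `φ` is locally Lipschitz on `(0,1]`, `Q` is
square-integrable, and dividing by `s - 1` and letting `s → 1` gives the equation for `Q`
(`IsEigenfunction.Q_eq`).

For the expansions, `T` is compact, being the pairing with the square-integrable `L²`-valued
function `x ↦ K(x,·)` (`isCompactOperator_compLpL₂_flip`), and symmetric. By the spectral theorem
and maximality, `T` kills every `g` orthogonal to all `φ_h`
(`IsMaximalEigensystem.integralOperator_eq_zero`); then `g` is orthogonal to the range of `T`, and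
also to `K(·,1)`, which is a limit of sections `K(·,x)` with `x < 1`. So `g` is orthogonal to `P`
and `Q`, and an orthogonal expansion converges for every vector with this property
(`tendsto_orthonormal_expansion`).
-/

namespace MertensKernel

/-! ### The kernel -/

lemma K_comm (x y : ℝ) : K x y = K y x := by
  simp only [K, and_comm, mul_comm]

lemma abs_K_le (x y : ℝ) : |K x y| ≤ 1 / 2 := by
  unfold K
  split_ifs
  · have h1 := Int.fract_nonneg ((x * y)⁻¹)
    have h2 := (Int.fract_lt_one ((x * y)⁻¹)).le
    rw [abs_le]; constructor <;> linarith
  · simp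

@[fun_prop]
lemma measurable_uncurry_K : Measurable (Function.uncurry K) := by
  unfold K Function.uncurry
  refine Measurable.ite ?_ (by fun_prop) measurable_const
  exact (measurableSet_lt measurable_const measurable_fst).inter
    (measurableSet_lt measurable_const measurable_snd)

@[fun_prop]
lemma measurable_K_right (x : ℝ) : Measurable (K x) :=
  measurable_uncurry_K.comp (measurable_const.prodMk measurable_id)

lemma K_mul_left {s : ℝ} (hs : 0 < s) (x y : ℝ) : K (s * x) y = K x (s * y) := by
  simp only [K, mul_pos_iff_of_pos_left hs]
  congr 3
  ring

@[simp] lemma K_zero_left (y : ℝ) : K 0 y = 0 := by simp [K]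

lemma K_of_pos {x y : ℝ} (hx : 0 < x) (hy : 0 < y) :
    K x y = 1 / 2 - Int.fract ((x * y)⁻¹) := by simp [K, hx, hy]

/-- Between two consecutive jumps `1 / ((n + 1) x)` and `1 / (n x)` the kernel is smooth. -/
lemma K_eq_of_mem_Ioc {x y : ℝ} {n : ℕ} (hx : 0 < x) (hy : 0 < y)
    (h1 : (n : ℝ) ≤ (x * y)⁻¹) (h2 : (x * y)⁻¹ < n + 1) :
    K x y = 1 / 2 + n - (x * y)⁻¹ := by
  have : ⌊(x * y)⁻¹⌋ = (n : ℤ) := by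
    rw [Int.floor_eq_iff]; exact ⟨by exact_mod_cast h1, by exact_mod_cast h2⟩
  rw [K_of_pos hx hy, Int.fract, this]
  push_cast; ring

lemma countable_jumps {x : ℝ} (hx : 0 < x) :
    {y : ℝ | (x * y)⁻¹ ∈ range ((↑) : ℤ → ℝ)}.Countable := by
  refine (countable_range (fun n : ℤ => x⁻¹ * (n : ℝ)⁻¹)).mono ?_
  rintro y ⟨n, hn⟩
  refine ⟨n, ?_⟩
  simp only [hn, inv_inv]
  field_simp

lemma ae_not_jump {x : ℝ} (hx : 0 < x) :
    ∀ᵐ y : ℝ, (x * y)⁻¹ ∉ range ((↑) : ℤ → ℝ) :=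
  (countable_jumps hx).ae_notMem _

lemma continuousAt_K_left {x y : ℝ} (hx : 0 < x) (hy : 0 < y)
    (h : (x * y)⁻¹ ∉ range ((↑) : ℤ → ℝ)) : ContinuousAt (fun t => K t y) x := by
  have h1 : ContinuousAt (fun t => 1 / 2 - Int.fract ((t * y)⁻¹)) x := by
    refine continuousAt_const.sub (ContinuousAt.comp (f := fun t => (t * y)⁻¹)
      (continuousAt_fract fun e => h ⟨⌊(x * y)⁻¹⌋, e.symm⟩) ?_)
    exact (continuousAt_id.mul continuousAt_const).inv₀ (mul_pos hx hy).ne'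
  refine h1.congr ?_
  filter_upwards [lt_mem_nhds hx] with t ht
  rw [K_of_pos ht hy]

lemma intervalIntegrable_K (x a b : ℝ) : IntervalIntegrable (K x) volume a b := by
  refine (intervalIntegrable_const (c := (1 / 2 : ℝ))).mono_fun
    (measurable_K_right x).aestronglyMeasurable (ae_of_all _ fun y => ?_)
  simpa using abs_K_le x y

lemma intervalIntegrable_K_mul {f : ℝ → ℝ} {a b : ℝ} (hf : IntervalIntegrable f volume a b)
    (x : ℝ) : IntervalIntegrable (fun y => K x y * f y) volume a b := by
  refine hf.mono_fun ((measurable_K_right x).aestronglyMeasurable.mul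
    hf.def'.aestronglyMeasurable) (ae_of_all _ fun y => ?_)
  have := abs_K_le x y
  have h2 := norm_nonneg (f y)
  have : ‖K x y‖ ≤ 1 := by rw [Real.norm_eq_abs]; linarith
  simp only [norm_mul]
  nlinarith

/-- The continuous primitive `{v}(1 - {v})/2` of `1/2 - {v}` yields a primitive of the kernel
up to a small error; hence the integral of the kernel over `[0, t]` is of second order in `t`. -/
lemma abs_integral_K_le {x t : ℝ} (hx : 0 < x) (ht : 0 ≤ t) :
    |∫ y in (0 : ℝ)..t, K x y| ≤ x / 2 * t ^ 2 := by
  set ρ : ℝ → ℝ := fun v => Int.fract v * (1 - Int.fract v) / 2 with hρ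
  have hρc : Continuous ρ := by
    have := ContinuousOn.comp_fract'' (f := fun v : ℝ => v * (1 - v) / 2)
      (by fun_prop) (by norm_num)
    exact this
  have hρb : ∀ v, |ρ v| ≤ 1 / 8 := fun v => by
    have h1 := Int.fract_nonneg v
    have h2 := (Int.fract_lt_one v).le
    simp only [hρ]
    rw [abs_le]; constructor <;> nlinarith [sq_nonneg (Int.fract v - 1 / 2)]
  have hρd : ∀ v, v ∉ range ((↑) : ℤ → ℝ) → HasDerivAt ρ (1 / 2 - Int.fract v) v := by
    intro v hv
    have h0 : HasDerivAt (fun w : ℝ => (w - ⌊v⌋) * (1 - (w - ⌊v⌋)) / 2)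
        ((1 * (1 - (v - ⌊v⌋)) + (v - ⌊v⌋) * (-1)) / 2) v := by
      have h1 : HasDerivAt (fun w : ℝ => w - ⌊v⌋) 1 v := (hasDerivAt_id v).sub_const _
      exact (h1.mul (h1.const_sub 1)).div_const 2
    have h2 : (1 * (1 - (v - ⌊v⌋)) + (v - ⌊v⌋) * (-1)) / 2 = 1 / 2 - Int.fract v := by
      rw [Int.fract]; ring
    rw [h2] at h0
    refine h0.congr_of_eventuallyEq ?_
    have hlt : (⌊v⌋ : ℝ) < v := lt_of_le_of_ne (Int.floor_le v) (fun h => hv ⟨_, h⟩)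
    filter_upwards [Ioo_mem_nhds hlt (Int.lt_floor_add_one v)] with w hw
    have : ⌊w⌋ = ⌊v⌋ := Int.floor_eq_iff.2 ⟨hw.1.le, hw.2⟩
    simp only [hρ, Int.fract, this]
  -- `G` is continuous on all of `[0, t]`, and `G' = K x - 2 x y ρ(1/(x y))` away from the jumps
  set G : ℝ → ℝ := fun y => -(x * y ^ 2 * ρ ((x * y)⁻¹)) with hG
  have hGb : ∀ y, |G y| ≤ x / 8 * y ^ 2 := fun y => by
    simp only [hG, abs_neg, abs_mul, abs_of_pos hx, abs_pow, sq_abs]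
    have := hρb ((x * y)⁻¹)
    nlinarith [mul_nonneg hx.le (sq_nonneg y)]
  have hGc : ContinuousOn G (Icc 0 t) := by
    intro y hy
    apply ContinuousAt.continuousWithinAt
    rcases hy.1.eq_or_lt with h0 | h0
    · rw [← h0]
      have hG0 : G 0 = 0 := by simp [hG]
      rw [ContinuousAt, hG0]
      refine squeeze_zero_norm (a := fun y => x / 8 * y ^ 2) hGb ?_
      have : Continuous fun y : ℝ => x / 8 * y ^ 2 := by fun_prop
      simpa using this.tendsto 0
    · have h1 : ContinuousAt (fun y : ℝ => (x * y)⁻¹) y :=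
        (continuousAt_const.mul continuousAt_id).inv₀ (mul_pos hx h0).ne'
      exact ((continuousAt_const.mul (continuousAt_id.pow 2)).mul
        (hρc.continuousAt.comp h1)).neg
  have hint : IntervalIntegrable (fun y => 2 * x * y * ρ ((x * y)⁻¹)) volume 0 t := by
    refine (Continuous.intervalIntegrable (u := fun y : ℝ => 2 * x * |y|) (by fun_prop)
      _ _).mono_fun ?_ (ae_of_all _ fun y => ?_)
    · exact (Measurable.mul (by fun_prop) (hρc.measurable.comp (by fun_prop))).aestronglyMeasurable
    · simp only [norm_mul, Real.norm_eq_abs, abs_abs]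
      have := hρb ((x * y)⁻¹)
      have h2 : 0 ≤ |(2 : ℝ)| * |x| * |y| := by positivity
      have h3 : |x| = x := abs_of_pos hx
      rw [h3] at h2 ⊢
      exact mul_le_of_le_one_right h2 (by linarith)
  have hFTC : ∫ y in (0 : ℝ)..t, (K x y - 2 * x * y * ρ ((x * y)⁻¹)) = G t - G 0 := by
    refine integral_eq_of_hasDerivAt_off_countable_of_le G _ ht (countable_jumps hx) hGc ?_
      ((intervalIntegrable_K x 0 t).sub hint)
    rintro y ⟨⟨hy0, -⟩, hy⟩
    have h1 : HasDerivAt (fun y : ℝ => (x * y)⁻¹) (-(x * 1) / (x * y) ^ 2) y :=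
      ((hasDerivAt_id y).const_mul x).inv (by simp only [id]; positivity)
    have h2 := (hρd _ hy).comp y h1
    have h3 : HasDerivAt (fun y : ℝ => x * y ^ 2) (x * (2 * y)) y := by
      simpa using (hasDerivAt_pow 2 y).const_mul x
    have h4 := (h3.mul h2).neg
    refine h4.congr_deriv ?_
    rw [K_of_pos hx hy0]
    simp only [Function.comp]
    field_simp
    ring
  rw [intervalIntegral.integral_sub (intervalIntegrable_K x 0 t) hint] at hFTC
  have hG0 : G 0 = 0 := by simp [hG]
  have h1 : ‖∫ y in (0 : ℝ)..t, 2 * x * y * ρ ((x * y)⁻¹)‖ ≤ ∫ y in (0 : ℝ)..t, x / 4 * y := by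
    refine intervalIntegral.norm_integral_le_of_norm_le ht (ae_of_all _ fun y hy => ?_)
      (Continuous.intervalIntegrable (by fun_prop) _ _)
    have := hρb ((x * y)⁻¹)
    have hxy : 0 < x * y := mul_pos hx hy.1
    rw [norm_mul, Real.norm_of_nonneg (by nlinarith : 0 ≤ 2 * x * y), Real.norm_eq_abs]
    nlinarith
  have h2 : ∫ y in (0 : ℝ)..t, x / 4 * y = x / 8 * t ^ 2 := by
    rw [intervalIntegral.integral_const_mul, integral_id]; ring
  rw [h2, Real.norm_eq_abs] at h1
  have h3 := hGb t
  have h5 : ∫ y in (0 : ℝ)..t, K x y = G t + ∫ y in (0 : ℝ)..t, 2 * x * y * ρ ((x * y)⁻¹) := by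
    linarith
  rw [h5]
  refine (abs_add_le _ _).trans ?_
  nlinarith [mul_nonneg hx.le (sq_nonneg t)]

/-- Integration by parts on an interval on which the kernel has no jump. -/
lemma abs_integral_smooth_piece_le {f : ℝ → ℝ} {x a b B c : ℝ} (hx : 0 < x) (ha : 0 < a)
    (hab : a ≤ b) (hf : IntervalIntegrable f volume 0 b) (hB : 0 ≤ B)
    (hΦ : ∀ t ∈ Icc 0 b, |∫ y in (0 : ℝ)..t, f y| ≤ B * t ^ 2)
    (hca : |c - (x * a)⁻¹| ≤ 1 / 2) (hcb : |c - (x * b)⁻¹| ≤ 1 / 2) :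
    |∫ y in a..b, (c - (x * y)⁻¹) * f y| ≤ B * b ^ 2 + B / x * (b - a) := by
  have hb : 0 < b := ha.trans_le hab
  have hfab : IntervalIntegrable f volume a b :=
    hf.mono_set (by rw [uIcc_of_le hab, uIcc_of_le hb.le]; exact Icc_subset_Icc_left ha.le)
  have hmemab : ∀ y ∈ Icc a b, y ≠ 0 := fun y hy => (ha.trans_le hy.1).ne'
  set g : ℝ → ℝ := fun y => c - (x * y)⁻¹ with hg
  have hgd : ∀ y, y ≠ 0 → HasDerivAt g (1 / (x * y ^ 2)) y := fun y hy => by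
    have h1 : HasDerivAt (fun y : ℝ => (x * y)⁻¹) (-(x * 1) / (x * y) ^ 2) y :=
      ((hasDerivAt_id y).const_mul x).inv (by simp only [id]; positivity)
    refine (h1.const_sub c).congr_deriv ?_
    field_simp
  have hgac : AbsolutelyContinuousOnInterval g a b := by
    refine ContDiffOn.absolutelyContinuousOnInterval ?_
    rw [uIcc_of_le hab]
    refine contDiffOn_const.sub (ContDiffOn.inv (contDiffOn_const.mul contDiffOn_id) ?_)
    intro y hy
    exact mul_ne_zero hx.ne' (hmemab y hy)
  set Φ : ℝ → ℝ := fun t => ∫ y in (0 : ℝ)..t, f y with hΦdef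
  have hΦac : AbsolutelyContinuousOnInterval Φ a b :=
    (hf.absolutelyContinuousOnInterval_intervalIntegral (by simp)).mono
      (by rw [uIcc_of_le hab, uIcc_of_le hb.le]; exact Icc_subset_Icc_left ha.le)
  have hparts := hgac.integral_mul_deriv_eq_deriv_mul hΦac
  have h1 : ∫ y in a..b, g y * deriv Φ y = ∫ y in a..b, g y * f y := by
    refine intervalIntegral.integral_congr_ae ?_
    filter_upwards [hf.ae_hasDerivAt_integral] with y hy hmem
    rw [uIoc_of_le hab] at hmem
    rw [(hy (by rw [uIcc_of_le hb.le]; exact ⟨(ha.trans hmem.1).le, hmem.2⟩) 0 (by simp)).deriv]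
  have h2 : ‖∫ y in a..b, deriv g y * Φ y‖ ≤ ∫ y in a..b, B / x := by
    refine intervalIntegral.norm_integral_le_of_norm_le hab (ae_of_all _ fun y hy => ?_)
      intervalIntegrable_const
    have hy0 : 0 < y := ha.trans hy.1
    rw [(hgd y hy0.ne').deriv, norm_mul, Real.norm_of_nonneg (by positivity), Real.norm_eq_abs]
    calc 1 / (x * y ^ 2) * |Φ y| ≤ 1 / (x * y ^ 2) * (B * y ^ 2) :=
          mul_le_mul_of_nonneg_left (hΦ y ⟨hy0.le, hy.2⟩) (by positivity)
      _ = B / x := by field_simp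
  rw [intervalIntegral.integral_const, smul_eq_mul, Real.norm_eq_abs] at h2
  rw [h1] at hparts
  change |∫ y in a..b, g y * f y| ≤ _
  rw [hparts]
  have h3 : |g b * Φ b| ≤ 1 / 2 * (B * b ^ 2) := by
    rw [abs_mul]
    exact mul_le_mul hcb (hΦ b ⟨hb.le, le_rfl⟩) (abs_nonneg _) (by norm_num)
  have h4 : |g a * Φ a| ≤ 1 / 2 * (B * b ^ 2) := by
    rw [abs_mul]
    refine mul_le_mul hca ((hΦ a ⟨ha.le, hab⟩).trans ?_) (abs_nonneg _) (by norm_num)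
    gcongr
  have h5 := abs_sub (g b * Φ b - g a * Φ a) (∫ y in a..b, deriv g y * Φ y)
  have h6 := abs_sub (g b * Φ b) (g a * Φ a)
  linarith [mul_comm (b - a) (B / x)]

/-- If the primitive of `f` is of second order at `0`, the oscillation of the kernel makes
`∫₀^δ K(x,y) f(y) dy` as small as `δ / x`. The integral is cut at the jumps `1 / (n x)` of the
kernel; each piece is at most a constant times its length over `x`. -/
lemma abs_integral_K_mul_le {f : ℝ → ℝ} {x δ B : ℝ} (hx : 0 < x) (hδ : 0 < δ) (hxδ : x * δ ≤ 1)
    (hf : IntervalIntegrable f volume 0 δ) (hB : 0 ≤ B)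
    (hΦ : ∀ t ∈ Icc 0 δ, |∫ y in (0 : ℝ)..t, f y| ≤ B * t ^ 2) :
    |∫ y in (0 : ℝ)..δ, K x y * f y| ≤ 4 * B * δ / x := by
  set m : ℕ := ⌊(x * δ)⁻¹⌋₊ with hm
  have hxδ0 : 0 < x * δ := mul_pos hx hδ
  have hm1 : 1 ≤ m := Nat.le_floor (by simpa using (one_le_inv₀ hxδ0).2 hxδ)
  have hmle : (m : ℝ) ≤ (x * δ)⁻¹ := Nat.floor_le (by positivity)
  have hmlt : (x * δ)⁻¹ < m + 1 := Nat.lt_floor_add_one _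
  -- the jumps of `K x` below `δ`, in decreasing order
  set t : ℕ → ℝ := fun n => (x * (m + 1 + n : ℝ))⁻¹ with ht
  have htpos : ∀ n, 0 < t n := fun n => by positivity
  have hxt : ∀ n, (x * t n)⁻¹ = m + 1 + n := fun n => by simp only [ht]; field_simp
  have ht0 : t 0 < δ := by
    have : (x * δ)⁻¹ < (x * t 0)⁻¹ := by rw [hxt]; push_cast; linarith
    have := (inv_lt_inv₀ hxδ0 (mul_pos hx (htpos 0))).1 this
    exact lt_of_mul_lt_mul_left this hx.le
  have hanti : ∀ n, t (n + 1) ≤ t n := fun n => by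
    simp only [ht]; gcongr; simp
  have hanti' : Antitone t := antitone_nat_of_succ_le hanti
  have hKf := intervalIntegrable_K_mul hf x
  have hsub : ∀ {a b : ℝ}, 0 ≤ a → a ≤ b → b ≤ δ →
      IntervalIntegrable (fun y => K x y * f y) volume a b := fun ha hab hb =>
    hKf.mono_set (by rw [uIcc_of_le hab, uIcc_of_le hδ.le]; exact Icc_subset_Icc ha hb)
  -- a piece inside one branch of the kernel
  have piece : ∀ {a b : ℝ} (n : ℕ), 0 < a → a ≤ b → b ≤ δ → (n : ℝ) ≤ (x * b)⁻¹ →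
      (x * a)⁻¹ ≤ n + 1 →
      |∫ y in a..b, K x y * f y| ≤ B * b ^ 2 + B / x * (b - a) := by
    intro a b n ha hab hb h1 h2
    have hb0 := ha.trans_le hab
    have hle : (x * b)⁻¹ ≤ (x * a)⁻¹ := by gcongr
    have hcongr : ∫ y in a..b, K x y * f y = ∫ y in a..b, ((1 / 2 + n) - (x * y)⁻¹) * f y := by
      refine intervalIntegral.integral_congr_ae (ae_of_all _ fun y hy => ?_)
      rw [uIoc_of_le hab] at hy
      have hy0 := ha.trans hy.1
      rw [K_eq_of_mem_Ioc hx hy0 (n := n)]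
      · refine h1.trans ?_
        have := hy.2
        gcongr
      · refine lt_of_lt_of_le ?_ h2
        have := hy.1
        gcongr
    rw [hcongr]
    refine abs_integral_smooth_piece_le hx ha hab (hf.mono_set ?_) hB
      (fun t ht => hΦ t ⟨ht.1, ht.2.trans hb⟩) ?_ ?_
    · rw [uIcc_of_le hb0.le, uIcc_of_le hδ.le]; exact Icc_subset_Icc_right hb
    · rw [abs_le]; constructor <;> linarith
    · rw [abs_le]; constructor <;> linarith
  have step : ∀ N : ℕ, |∫ y in t N..δ, K x y * f y| ≤
      B * δ ^ 2 + B / x * (δ - t 0) + 3 * B / x * (t 0 - t N) := by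
    intro N
    induction N with
    | zero =>
      have := piece (a := t 0) (b := δ) m (htpos 0) ht0.le le_rfl hmle (by rw [hxt]; simp)
      simpa using this
    | succ N ih =>
      have hN : t N ≤ δ := (hanti' (Nat.zero_le N)).trans ht0.le
      have h1 := piece (a := t (N + 1)) (b := t N) (m + 1 + N) (htpos _) (hanti N) hN
        (by rw [hxt]; push_cast; rfl) (by rw [hxt]; push_cast; linarith)
      rw [← intervalIntegral.integral_add_adjacent_intervals
        (hsub (htpos _).le (hanti N) hN) (hsub (htpos _).le hN le_rfl)]
      -- consecutive jumps are far enough apart to absorb the boundary term `B * t N ^ 2`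
      have h2 : t N ^ 2 ≤ 2 / x * (t N - t (N + 1)) := by
        simp only [ht]
        push_cast
        have : (0 : ℝ) ≤ N := Nat.cast_nonneg N
        have : (0 : ℝ) ≤ m := Nat.cast_nonneg m
        rw [← sub_nonneg]
        have : 2 / x * ((x * (m + 1 + N : ℝ))⁻¹ - (x * (m + 1 + (N + 1) : ℝ))⁻¹)
            - (x * (m + 1 + N : ℝ))⁻¹ ^ 2
            = (m + N) / (x ^ 2 * (m + 1 + N) ^ 2 * (m + 1 + (N + 1))) := by
          field_simp
          ring
        rw [this]
        positivity
      have h3 : B * t N ^ 2 ≤ B * (2 / x * (t N - t (N + 1))) := by gcongr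
      refine (abs_add_le _ _).trans ((add_le_add h1 ih).trans ?_)
      have e1 : B * (2 / x * (t N - t (N + 1))) + B / x * (t N - t (N + 1))
          = 3 * B / x * (t N - t (N + 1)) := by ring
      nlinarith
  have htlim : Tendsto t atTop (𝓝 0) := by
    refine Tendsto.inv_tendsto_atTop (Tendsto.const_mul_atTop hx ?_)
    exact tendsto_atTop_add_const_left _ _ tendsto_natCast_atTop_atTop
  have hcont : ContinuousOn (fun a => ∫ y in a..δ, K x y * f y) (Icc 0 δ) := by
    have h1 := intervalIntegral.continuousOn_primitive_interval_left
      (f := fun y => K x y * f y) (μ := volume) (a := 0) (b := δ)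
      (by rw [uIcc_of_le hδ.le]; exact (intervalIntegrable_iff_integrableOn_Icc_of_le hδ.le).1 hKf)
    rwa [uIcc_of_le hδ.le] at h1
  have hlim : Tendsto (fun N => ∫ y in t N..δ, K x y * f y) atTop
      (𝓝 (∫ y in (0 : ℝ)..δ, K x y * f y)) := by
    refine (hcont 0 ⟨le_rfl, hδ.le⟩).tendsto.comp (tendsto_nhdsWithin_iff.2 ⟨htlim, ?_⟩)
    exact Eventually.of_forall fun N =>
      ⟨(htpos N).le, (hanti' (Nat.zero_le N)).trans ht0.le⟩
  refine le_of_tendsto hlim.abs (Eventually.of_forall fun N => (step N).trans ?_)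
  have h1 : B * δ ^ 2 ≤ B * δ / x := by
    rw [le_div_iff₀ hx]
    have : B * δ * (x * δ) ≤ B * δ * 1 := by gcongr
    nlinarith
  have h2 : B / x * (δ - t 0) + 3 * B / x * (t 0 - t N) ≤ 3 * (B * δ / x) := by
    have : 0 ≤ B / x := by positivity
    have e : 3 * (B * δ / x) - (B / x * (δ - t 0) + 3 * B / x * (t 0 - t N))
      = B / x * (2 * (δ - t 0) + 3 * t N) := by ring
    have : 0 ≤ B / x * (2 * (δ - t 0) + 3 * t N) := by
      have := htpos N
      apply mul_nonneg (by positivity); linarith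
    linarith
  calc _ ≤ B * δ / x + 3 * (B * δ / x) := by linarith
    _ = 4 * B * δ / x := by ring

/-- The iterated kernel `∫₀¹ K(x,y) K(y,z) dy` is small when `x` is much smaller than `z`. -/
lemma abs_integral_K_mul_K_le {x z : ℝ} (hx : 0 < x) (hz : 0 < z) (hz1 : z ≤ 1) :
    |∫ y in (0 : ℝ)..1, K x y * K y z| ≤ 2 * x / z := by
  have h := abs_integral_K_mul_le (f := K x) (x := z) (δ := 1) (B := x / 2) hz one_pos
    (by linarith) (intervalIntegrable_K x 0 1) (by positivity)
    (fun t ht => abs_integral_K_le hx ht.1)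
  have e : ∫ y in (0 : ℝ)..1, K x y * K y z = ∫ y in (0 : ℝ)..1, K z y * K x y := by
    simp only [K_comm z, mul_comm]
  rw [e]
  refine h.trans (le_of_eq (by ring))

/-! ### Regularity of eigenfunctions -/

namespace IsEigenfunction

variable {φ : ℝ → ℝ} {μ : ℝ}

lemma intervalIntegrable (h : IsEigenfunction φ μ) : IntervalIntegrable φ volume 0 1 :=
  (intervalIntegrable_iff_integrableOn_Icc_of_le zero_le_one).2
    (h.memLp.integrable one_le_two)

lemma intervalIntegrable_of_mem (h : IsEigenfunction φ μ) {a b : ℝ} (ha : a ∈ Icc (0 : ℝ) 1)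
    (hb : b ∈ Icc (0 : ℝ) 1) : IntervalIntegrable φ volume a b :=
  h.intervalIntegrable.mono_set (by
    rw [uIcc_of_le zero_le_one]; exact uIcc_subset_Icc ha hb)

lemma intervalIntegrable_comp_mul (h : IsEigenfunction φ μ) {s : ℝ} (hs : s ∈ Ioo (0 : ℝ) 1) :
    IntervalIntegrable (fun y => φ (s * y)) volume 0 1 := by
  have h1 := (h.intervalIntegrable_of_mem (a := 0) (b := s) (by simp)
    ⟨hs.1.le, hs.2.le⟩).comp_mul_left (c := s)
  simpa [hs.1.ne'] using h1

lemma eigenvalue_ne_zero (h : IsEigenfunction φ μ) : μ ≠ 0 := by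
  rintro rfl
  have h1 : ip φ φ = 0 := by
    unfold ip
    have : ∫ x in (0 : ℝ)..1, φ x * φ x = ∫ x in (0 : ℝ)..1, (0 : ℝ) := by
      refine intervalIntegral.integral_congr fun x hx => ?_
      rw [uIcc_of_le zero_le_one] at hx
      simp [h.eq x hx]
    simpa using this
  exact h.norm_pos.ne' h1

lemma exists_bound (h : IsEigenfunction φ μ) :
    ∃ M, 0 ≤ M ∧ ∀ x ∈ Icc (0 : ℝ) 1, |φ x| ≤ M := by
  have hint : IntervalIntegrable (fun y => |φ y|) volume 0 1 := h.intervalIntegrable.abs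
  refine ⟨|μ| * ∫ y in (0 : ℝ)..1, |φ y|, mul_nonneg (abs_nonneg _)
    (intervalIntegral.integral_nonneg zero_le_one fun _ _ => abs_nonneg _), fun x hx => ?_⟩
  rw [h.eq x hx, abs_mul]
  refine mul_le_mul_of_nonneg_left ?_ (abs_nonneg _)
  refine (Real.norm_eq_abs _).ge.trans
          (intervalIntegral.norm_integral_le_of_norm_le
            zero_le_one (ae_of_all _ fun y _ => ?_) hint)
  rw [norm_mul, Real.norm_eq_abs, Real.norm_eq_abs]
  nlinarith [abs_K_le x y, abs_nonneg (φ y)]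

/-- An eigenfunction also satisfies the equation with the iterated kernel. -/
lemma eq_iterated (h : IsEigenfunction φ μ) {x : ℝ} (hx : x ∈ Icc (0 : ℝ) 1) :
    φ x = μ ^ 2 * ∫ z in (0 : ℝ)..1, (∫ y in (0 : ℝ)..1, K x y * K y z) * φ z := by
  have h1 : ∫ y in (0 : ℝ)..1, K x y * φ y
      = ∫ y in (0 : ℝ)..1, μ * ∫ z in (0 : ℝ)..1, K x y * K y z * φ z := by
    refine intervalIntegral.integral_congr fun y hy => ?_
    rw [uIcc_of_le zero_le_one] at hy
    simp only [mul_assoc, intervalIntegral.integral_const_mul]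
    rw [h.eq y hy]
    ring
  have hswap : ∫ y in (0 : ℝ)..1, ∫ z in (0 : ℝ)..1, K x y * K y z * φ z
      = ∫ z in (0 : ℝ)..1, ∫ y in (0 : ℝ)..1, K x y * K y z * φ z := by
    simp only [intervalIntegral.integral_of_le zero_le_one]
    refine integral_integral_swap ?_
    have h2 : Integrable (fun p : ℝ × ℝ => φ p.2)
        ((volume.restrict (Ioc (0 : ℝ) 1)).prod (volume.restrict (Ioc (0 : ℝ) 1))) :=
      (h.intervalIntegrable.1).comp_snd _
    refine h2.bdd_mul (c := 1) (f := fun p : ℝ × ℝ => K x p.1 * K p.1 p.2) ?_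
      (ae_of_all _ fun p => ?_)
    · exact (((measurable_K_right x).comp measurable_fst).mul
        measurable_uncurry_K).aestronglyMeasurable
    · rw [norm_mul, Real.norm_eq_abs, Real.norm_eq_abs]
      nlinarith [abs_K_le x p.1, abs_K_le p.1 p.2, abs_nonneg (K x p.1), abs_nonneg (K p.1 p.2)]
  rw [h.eq x hx, h1, intervalIntegral.integral_const_mul, hswap]
  simp only [intervalIntegral.integral_mul_const]
  ring

lemma integral_rpow_neg_half : ∫ z in (0 : ℝ)..1, z ^ (-(1 / 2) : ℝ) = 2 := by
  rw [integral_rpow (Or.inl (by norm_num))]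
  norm_num

/-- An eigenfunction vanishes to first order at `0`. The estimate `|K₂(x,z)| ≤ min(1, 2x/z)` for
the iterated kernel first gives the order `1/2`, and with this the full order. -/
lemma exists_linear_bound (h : IsEigenfunction φ μ) :
    ∃ C, 0 ≤ C ∧ ∀ x ∈ Icc (0 : ℝ) 1, |φ x| ≤ C * x := by
  obtain ⟨M, hM, hMb⟩ := h.exists_bound
  have hzero : φ 0 = 0 := by
    rw [h.eq 0 (by simp)]; simp
  have hri : IntervalIntegrable (fun z : ℝ => z ^ (-(1 / 2) : ℝ)) volume 0 1 :=
    intervalIntegral.intervalIntegrable_rpow' (by norm_num)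
  -- the iterated equation turns a bound of the integrand by `A z ^ (-1/2)` into a bound of `φ`
  have key : ∀ x ∈ Ioc (0 : ℝ) 1, ∀ A : ℝ,
      (∀ z ∈ Ioc (0 : ℝ) 1, |∫ y in (0 : ℝ)..1, K x y * K y z| * |φ z|
        ≤ A * z ^ (-(1 / 2) : ℝ)) → |φ x| ≤ μ ^ 2 * (A * 2) := by
    intro x hx A hA
    rw [h.eq_iterated ⟨hx.1.le, hx.2⟩, abs_mul, abs_of_nonneg (sq_nonneg μ)]
    refine mul_le_mul_of_nonneg_left ?_ (sq_nonneg μ)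
    rw [← integral_rpow_neg_half, ← intervalIntegral.integral_const_mul]
    refine (Real.norm_eq_abs _).ge.trans
          (intervalIntegral.norm_integral_le_of_norm_le
            zero_le_one (ae_of_all _ fun z hz => ?_)
      (hri.const_mul A))
    rw [norm_mul]
    exact hA z hz
  have hK2 : ∀ x z : ℝ, |∫ y in (0 : ℝ)..1, K x y * K y z| ≤ 1 := by
    intro x z
    have := intervalIntegral.norm_integral_le_of_norm_le_const (a := (0 : ℝ)) (b := 1) (C := 1)
      (f := fun y => K x y * K y z) (fun y _ => by
        rw [norm_mul, Real.norm_eq_abs, Real.norm_eq_abs]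
        nlinarith [abs_K_le x y, abs_K_le y z, abs_nonneg (K x y), abs_nonneg (K y z)])
    simpa using this
  have half : ∀ x ∈ Ioc (0 : ℝ) 1, |φ x| ≤ μ ^ 2 * ((M * √(2 * x)) * 2) := by
    intro x hx
    refine key x hx _ fun z hz => ?_
    have h1 := abs_integral_K_mul_K_le hx.1 hz.1 hz.2
    have h2 := hK2 x z
    have h3 : |∫ y in (0 : ℝ)..1, K x y * K y z| ≤ √(2 * x / z) := by
      apply Real.le_sqrt_of_sq_le
      have := abs_nonneg (∫ y in (0 : ℝ)..1, K x y * K y z)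
      nlinarith
    rw [Real.rpow_neg hz.1.le, ← Real.sqrt_eq_rpow]
    calc _ ≤ √(2 * x / z) * M := mul_le_mul h3 (hMb z ⟨hz.1.le, hz.2⟩) (abs_nonneg _)
          (by positivity)
      _ = M * √(2 * x) * (√z)⁻¹ := by
        rw [Real.sqrt_div (by linarith [hx.1])]; ring
  set A : ℝ := μ ^ 2 * ((M * √2) * 2) with hA
  have hA0 : 0 ≤ A := by positivity
  refine ⟨μ ^ 2 * (2 * A * 2), by positivity, fun x hx => ?_⟩
  rcases hx.1.eq_or_lt with h0 | h0
  · rw [← h0, hzero]; simp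
  · have := key x ⟨h0, hx.2⟩ (2 * A * x) fun z hz => ?_
    · linarith
    have h1 := abs_integral_K_mul_K_le h0 hz.1 hz.2
    have h2 : |φ z| ≤ A * √z := by
      refine (half z hz).trans (le_of_eq ?_)
      rw [Real.sqrt_mul (by norm_num)]; ring
    rw [Real.rpow_neg hz.1.le, ← Real.sqrt_eq_rpow]
    have hz0 := hz.1
    calc _ ≤ 2 * x / z * (A * √z) := mul_le_mul h1 h2 (abs_nonneg _) (by positivity)
      _ = 2 * A * x * (√z / z) := by ring
      _ = 2 * A * x * (√z)⁻¹ := by rw [Real.sqrt_div_self', one_div]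

/-- How an eigenfunction changes under the dilation `x ↦ s x`: the eigenvalue equation
reproduces the difference `φ(s·) - φ`, up to terms of order `1 - s`. -/
lemma sub_comp_mul_eq (h : IsEigenfunction φ μ) {s x : ℝ} (hs : s ∈ Ioo (0 : ℝ) 1)
    (hx : x ∈ Ioc (0 : ℝ) 1) :
    φ (s * x) - φ x = (s⁻¹ - 1) * φ x - μ * s⁻¹ * (∫ u in s..1, K x u * φ u)
      - μ * ∫ y in (0 : ℝ)..1, K (s * x) y * (φ (s * y) - φ y) := by
  have hs0 := hs.1
  have hsx : s * x ∈ Icc (0 : ℝ) 1 :=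
    ⟨by have := hx.1; positivity, mul_le_one₀ hs.2.le hx.1.le hx.2⟩
  have h1 : ∫ y in (0 : ℝ)..1, K (s * x) y * (φ (s * y) - φ y)
      = s⁻¹ * (∫ u in (0 : ℝ)..s, K x u * φ u) - ∫ y in (0 : ℝ)..1, K (s * x) y * φ y := by
    simp only [mul_sub]
    rw [intervalIntegral.integral_sub
      (intervalIntegrable_K_mul (h.intervalIntegrable_comp_mul hs) _)
      (intervalIntegrable_K_mul h.intervalIntegrable _)]
    congr 1
    have := intervalIntegral.integral_comp_mul_left (a := 0) (b := 1)
      (fun u => K x u * φ u) hs0.ne'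
    simp only [mul_zero, mul_one, smul_eq_mul] at this
    rw [← this]
    simp only [K_mul_left hs0]
  have h2 : (∫ u in (0 : ℝ)..s, K x u * φ u) + ∫ u in s..1, K x u * φ u
      = ∫ u in (0 : ℝ)..1, K x u * φ u :=
    intervalIntegral.integral_add_adjacent_intervals
      (intervalIntegrable_K_mul (h.intervalIntegrable_of_mem (by simp) ⟨hs0.le, hs.2.le⟩) x)
      (intervalIntegrable_K_mul (h.intervalIntegrable_of_mem ⟨hs0.le, hs.2.le⟩ (by simp)) x)
  have h3 := h.eq x ⟨hx.1.le, hx.2⟩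
  have h4 := h.eq _ hsx
  rw [h1, eq_sub_of_add_eq h2]
  generalize (∫ u in (0 : ℝ)..1, K x u * φ u) = I at *
  generalize (∫ u in s..1, K x u * φ u) = J at *
  generalize (∫ y in (0 : ℝ)..1, K (s * x) y * φ y) = L at *
  rw [h3, h4]
  ring

lemma abs_integral_sub_comp_mul_le (h : IsEigenfunction φ μ) {C : ℝ}
    (hC0 : 0 ≤ C) (hC : ∀ x ∈ Icc (0 : ℝ) 1, |φ x| ≤ C * x) {s t : ℝ} (hs : s ∈ Ioo (0 : ℝ) 1)
    (ht : t ∈ Icc (0 : ℝ) 1) :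
    |∫ y in (0 : ℝ)..t, (φ (s * y) - φ y)| ≤ 2 * C * (1 - s) * t ^ 2 := by
  have hs0 := hs.1
  have hst : s * t ≤ t := mul_le_of_le_one_left ht.1 hs.2.le
  have hst0 : 0 ≤ s * t := mul_nonneg hs0.le ht.1
  have hstm : s * t ∈ Icc (0 : ℝ) 1 := ⟨hst0, hst.trans ht.2⟩
  have hi : ∀ {f : ℝ → ℝ}, IntervalIntegrable f volume 0 1 → IntervalIntegrable f volume 0 t :=
    fun hf => hf.mono_set (by
      rw [uIcc_of_le zero_le_one, uIcc_of_le ht.1]; exact Icc_subset_Icc_right ht.2)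
  have h1 : ∫ y in (0 : ℝ)..t, (φ (s * y) - φ y)
      = (s⁻¹ - 1) * (∫ u in (0 : ℝ)..(s * t), φ u) - ∫ u in (s * t)..t, φ u := by
    rw [intervalIntegral.integral_sub (hi (h.intervalIntegrable_comp_mul hs))
      (hi h.intervalIntegrable), intervalIntegral.integral_comp_mul_left _ hs0.ne',
      ← intervalIntegral.integral_add_adjacent_intervals
        (h.intervalIntegrable_of_mem (by simp) hstm) (h.intervalIntegrable_of_mem hstm ht)]
    simp only [mul_zero, smul_eq_mul]
    ring
  have h2 : |∫ u in (0 : ℝ)..(s * t), φ u| ≤ C * (s * t) * |s * t - 0| := by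
    refine (Real.norm_eq_abs _).ge.trans
          (intervalIntegral.norm_integral_le_of_norm_le_const fun y hy => ?_)
    rw [uIoc_of_le hst0] at hy
    refine (hC y ⟨hy.1.le, hy.2.trans hstm.2⟩).trans ?_
    exact mul_le_mul_of_nonneg_left hy.2 hC0
  have h3 : |∫ u in (s * t)..t, φ u| ≤ C * t * |t - s * t| := by
    refine (Real.norm_eq_abs _).ge.trans
          (intervalIntegral.norm_integral_le_of_norm_le_const fun y hy => ?_)
    rw [uIoc_of_le hst] at hy
    refine (hC y ⟨hst0.trans hy.1.le, hy.2.trans ht.2⟩).trans ?_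
    exact mul_le_mul_of_nonneg_left hy.2 hC0
  rw [sub_zero, abs_of_nonneg hst0] at h2
  rw [abs_of_nonneg (sub_nonneg.2 hst)] at h3
  have hs1 : 0 ≤ s⁻¹ - 1 := by
    have := (one_le_inv₀ hs0).2 hs.2.le
    linarith
  rw [h1]
  refine (abs_sub _ _).trans ?_
  rw [abs_mul, abs_of_nonneg hs1]
  have h4 : (s⁻¹ - 1) * |∫ u in (0 : ℝ)..(s * t), φ u| ≤ (s⁻¹ - 1) * (C * (s * t) * (s * t)) :=
    mul_le_mul_of_nonneg_left h2 hs1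
  have h5 : (s⁻¹ - 1) * (C * (s * t) * (s * t)) = (1 - s) * s * (C * t ^ 2) := by
    field_simp
  have h6 : (1 - s) * s * (C * t ^ 2) ≤ (1 - s) * 1 * (C * t ^ 2) := by
    have := hs.2.le
    have : 0 ≤ 1 - s := by linarith
    gcongr
  linarith

/-- Quantitative regularity under dilation. The oscillation estimate for the kernel, applied on
`[0,1]`, first gives the weaker bound `(1 - s) / x`; splitting the integral at `x` then reduces
the loss to a logarithm. -/
lemma exists_dilation_bound (h : IsEigenfunction φ μ) :
    ∃ D, 0 ≤ D ∧ ∀ s ∈ Ioo (0 : ℝ) 1, ∀ x ∈ Ioc (0 : ℝ) 1,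
      |φ (s * x) - φ x| ≤ D * (1 - s) * x ^ (-(1 / 4) : ℝ) := by
  obtain ⟨C, hC0, hC⟩ := h.exists_linear_bound
  have hC1 : ∀ x ∈ Icc (0 : ℝ) 1, |φ x| ≤ C := fun x hx =>
    (hC x hx).trans (mul_le_of_le_one_right hC0 hx.2)
  have hΔi : ∀ {s : ℝ}, s ∈ Ioo (0 : ℝ) 1 →
      IntervalIntegrable (fun y => φ (s * y) - φ y) volume 0 1 := fun hs =>
    (h.intervalIntegrable_comp_mul hs).sub h.intervalIntegrable
  -- reduction to the integral against the difference
  have main : ∀ s ∈ Ioo (0 : ℝ) 1, 1 / 2 ≤ s → ∀ x ∈ Ioc (0 : ℝ) 1, |φ (s * x) - φ x| ≤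
      (1 - s) * (2 * C + |μ| * C)
        + |μ| * |∫ y in (0 : ℝ)..1, K (s * x) y * (φ (s * y) - φ y)| := by
    intro s hs hs2 x hx
    have hs0 := hs.1
    have hs1 : 0 ≤ 1 - s := by linarith [hs.2]
    have hinv : s⁻¹ ≤ 2 := by
      rw [inv_le_comm₀ hs0 (by norm_num)]; linarith
    have hinv1 : 0 ≤ s⁻¹ - 1 := by
      have := (one_le_inv₀ hs0).2 hs.2.le
      linarith
    rw [h.sub_comp_mul_eq hs hx]
    refine (abs_sub _ _).trans ?_
    rw [abs_mul μ (∫ y in (0 : ℝ)..1, K (s * x) y * (φ (s * y) - φ y))]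
    refine add_le_add ?_ le_rfl
    refine (abs_sub _ _).trans ?_
    have h1 : |(s⁻¹ - 1) * φ x| ≤ (1 - s) * (2 * C) := by
      rw [abs_mul, abs_of_nonneg hinv1]
      have : s⁻¹ - 1 = (1 - s) * s⁻¹ := by field_simp
      rw [this, mul_assoc]
      have := hC1 x ⟨hx.1.le, hx.2⟩
      gcongr
    have h2 : |∫ u in s..1, K x u * φ u| ≤ 1 / 2 * C * |1 - s| := by
      refine (Real.norm_eq_abs _).ge.trans
          (intervalIntegral.norm_integral_le_of_norm_le_const fun y hy => ?_)
      rw [uIoc_of_le hs.2.le] at hy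
      rw [norm_mul]
      exact mul_le_mul (abs_K_le x y) (hC1 y ⟨(hs0.trans hy.1).le, hy.2⟩) (abs_nonneg _)
        (by norm_num)
    rw [abs_of_nonneg hs1] at h2
    have h3 : |μ * s⁻¹ * ∫ u in s..1, K x u * φ u| ≤ (1 - s) * (|μ| * C) := by
      rw [abs_mul, abs_mul, abs_of_pos (inv_pos.2 hs0)]
      calc _ ≤ |μ| * 2 * (1 / 2 * C * (1 - s)) := by gcongr
        _ = _ := by ring
    linarith
  -- the oscillation estimate on `[0, δ]`
  have osc : ∀ s ∈ Ioo (0 : ℝ) 1, 1 / 2 ≤ s → ∀ x ∈ Ioc (0 : ℝ) 1, ∀ δ ∈ Ioc (0 : ℝ) 1,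
      |∫ y in (0 : ℝ)..δ, K (s * x) y * (φ (s * y) - φ y)| ≤ 16 * C * (1 - s) * δ / x := by
    intro s hs hs2 x hx δ hδ
    have hs0 := hs.1
    have hx0 := hx.1
    have hδ0 := hδ.1
    have hs1 : 0 ≤ 1 - s := by linarith [hs.2]
    have h1 := abs_integral_K_mul_le (f := fun y => φ (s * y) - φ y) (x := s * x) (δ := δ)
      (B := 2 * C * (1 - s)) (mul_pos hs.1 hx.1) hδ.1
      (mul_le_one₀ (mul_le_one₀ hs.2.le hx.1.le hx.2) hδ.1.le hδ.2)
      ((hΔi hs).mono_set (by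
        rw [uIcc_of_le zero_le_one, uIcc_of_le hδ.1.le]; exact Icc_subset_Icc_right hδ.2))
      (by positivity)
      (fun t ht => h.abs_integral_sub_comp_mul_le hC0 hC hs ⟨ht.1, ht.2.trans hδ.2⟩)
    refine h1.trans ?_
    rw [div_le_div_iff₀ (by positivity) (by positivity)]
    have : 8 * C * (1 - s) * δ * x * 1 ≤ 8 * C * (1 - s) * δ * x * (2 * s) := by
      gcongr; linarith
    linarith
  set C₁ : ℝ := 4 * C + 17 * |μ| * C with hC₁
  have hC₁0 : 0 ≤ C₁ := by positivity
  -- away from `s = 1` the trivial bound suffices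
  have small : ∀ s ∈ Ioo (0 : ℝ) 1, s < 1 / 2 → ∀ x ∈ Ioc (0 : ℝ) 1,
      |φ (s * x) - φ x| ≤ 4 * C * (1 - s) := by
    intro s hs hs2 x hx
    have h1 := hC1 (s * x) ⟨mul_nonneg hs.1.le hx.1.le, mul_le_one₀ hs.2.le hx.1.le hx.2⟩
    have h2 := hC1 x ⟨hx.1.le, hx.2⟩
    refine (abs_sub _ _).trans ?_
    nlinarith
  have weak : ∀ s ∈ Ioo (0 : ℝ) 1, 1 / 2 ≤ s → ∀ x ∈ Ioc (0 : ℝ) 1,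
      |φ (s * x) - φ x| ≤ C₁ * (1 - s) * x⁻¹ := by
    intro s hs hs2 x hx
    have hs1 : 0 ≤ 1 - s := by linarith [hs.2]
    have hxi : 1 ≤ x⁻¹ := (one_le_inv₀ hx.1).2 hx.2
    have h1 := osc s hs hs2 x hx 1 (by simp)
    have h2 : |μ| * |∫ y in (0 : ℝ)..1, K (s * x) y * (φ (s * y) - φ y)|
        ≤ |μ| * (16 * C * (1 - s) * 1 / x) := by gcongr
    have h3 : (1 - s) * (2 * C + |μ| * C) * 1 ≤ (1 - s) * (4 * C + |μ| * C) * x⁻¹ := by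
      gcongr; norm_num
    refine (main s hs hs2 x hx).trans ?_
    calc _ ≤ (1 - s) * (4 * C + |μ| * C) * x⁻¹ + |μ| * (16 * C * (1 - s) * 1 / x) := by linarith
      _ = C₁ * (1 - s) * x⁻¹ := by rw [hC₁, div_eq_mul_inv]; ring
  refine ⟨C₁ + 2 * |μ| * C₁, by positivity, fun s hs x hx => ?_⟩
  have hs1 : 0 ≤ 1 - s := by linarith [hs.2]
  have hx0 := hx.1
  have hxp : 1 ≤ x ^ (-(1 / 4) : ℝ) := Real.one_le_rpow_of_pos_of_le_one_of_nonpos hx.1 hx.2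
    (by norm_num)
  rcases lt_or_ge s (1 / 2) with hs2 | hs2
  · refine (small s hs hs2 x hx).trans ?_
    have h0 : 4 * C * (1 - s) * 1 ≤ (C₁ + 2 * |μ| * C₁) * (1 - s) * x ^ (-(1 / 4) : ℝ) := by
      gcongr
      have : 0 ≤ 17 * |μ| * C + 2 * |μ| * C₁ := by positivity
      rw [hC₁] at *
      linarith
    linarith
  · -- on `[0, x]` use the oscillation of the kernel, on `[x, 1]` the bound `weak`
    have hKi := intervalIntegrable_K_mul (hΔi hs) (s * x)
    have h1 : |∫ y in (0 : ℝ)..x, K (s * x) y * (φ (s * y) - φ y)| ≤ 16 * C * (1 - s) := by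
      have := osc s hs hs2 x hx x hx
      rwa [mul_div_assoc, div_self hx.1.ne', mul_one] at this
    have h2 : |∫ y in x..1, K (s * x) y * (φ (s * y) - φ y)|
        ≤ ∫ y in x..1, 1 / 2 * (C₁ * (1 - s)) * y⁻¹ := by
      refine (Real.norm_eq_abs _).ge.trans
          (intervalIntegral.norm_integral_le_of_norm_le
            hx.2 (ae_of_all _ fun y hy => ?_) ?_)
      · rw [norm_mul, mul_assoc]
        exact mul_le_mul (abs_K_le _ y) (weak s hs hs2 y ⟨hx.1.trans hy.1, hy.2⟩) (abs_nonneg _)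
          (by norm_num)
      · refine IntervalIntegrable.const_mul (intervalIntegral.intervalIntegrable_inv ?_
          continuousOn_id) _
        intro y hy
        rw [uIcc_of_le hx.2] at hy
        exact (hx.1.trans_le hy.1).ne'
    have hlog : Real.log (1 / x) ≤ 4 * x ^ (-(1 / 4) : ℝ) := by
      have := Real.log_le_rpow_div (x := 1 / x) (by positivity) (show (0 : ℝ) < 1 / 4 by norm_num)
      rw [one_div x, Real.inv_rpow hx0.le, ← Real.rpow_neg hx0.le] at this
      rw [one_div x]
      linarith
    rw [intervalIntegral.integral_const_mul, integral_inv_of_pos hx.1 one_pos] at h2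
    have h3 : 1 / 2 * (C₁ * (1 - s)) * Real.log (1 / x)
        ≤ 1 / 2 * (C₁ * (1 - s)) * (4 * x ^ (-(1 / 4) : ℝ)) := by gcongr
    have h4 : |∫ y in (0 : ℝ)..1, K (s * x) y * (φ (s * y) - φ y)|
        ≤ 16 * C * (1 - s) + 1 / 2 * (C₁ * (1 - s)) * (4 * x ^ (-(1 / 4) : ℝ)) := by
      rw [← intervalIntegral.integral_add_adjacent_intervals (b := x)
        (hKi.mono_set (by
          rw [uIcc_of_le zero_le_one, uIcc_of_le hx.1.le]; exact Icc_subset_Icc_right hx.2))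
        (hKi.mono_set (by
          rw [uIcc_of_le zero_le_one, uIcc_of_le hx.2]; exact Icc_subset_Icc_left hx.1.le))]
      refine (abs_add_le _ _).trans ?_
      linarith
    refine (main s hs hs2 x hx).trans ?_
    have h5 : |μ| * |∫ y in (0 : ℝ)..1, K (s * x) y * (φ (s * y) - φ y)| ≤ |μ| *
      (16 * C * (1 - s) + 1 / 2 * (C₁ * (1 - s)) * (4 * x ^ (-(1 / 4) : ℝ))) := by gcongr
    have h6 : C₁ * (1 - s) * 1 ≤ C₁ * (1 - s) * x ^ (-(1 / 4) : ℝ) := by gcongr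
    have h7 : (1 - s) * (2 * C + |μ| * C) + |μ| * (16 * C * (1 - s)) ≤ C₁ * (1 - s) := by
      rw [hC₁]
      have : 0 ≤ 2 * C * (1 - s) := by positivity
      linarith
    linarith

end IsEigenfunction

/-! ### The derivative of an eigenfunction -/

lemma ae_unit_iff_Ioo {p : ℝ → Prop} :
    (∀ᵐ x ∂unitMeasure, p x) ↔ ∀ᵐ x, x ∈ Ioo (0 : ℝ) 1 → p x := by
  rw [unitMeasure, ← restrict_Ioo_eq_restrict_Icc, ae_restrict_iff' measurableSet_Ioo]

lemma intervalIntegral_eq_unit (g : ℝ → ℝ) :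
    ∫ x in (0 : ℝ)..1, g x = ∫ x, g x ∂unitMeasure := by
  rw [intervalIntegral.integral_of_le zero_le_one, integral_Icc_eq_integral_Ioc]

namespace IsEigenfunction

variable {φ : ℝ → ℝ} {μ : ℝ}

lemma ae_differentiableAt (h : IsEigenfunction φ μ) :
    ∀ᵐ x, x ∈ Ioo (0 : ℝ) 1 → DifferentiableAt ℝ φ x := by
  obtain ⟨D, hD0, hD⟩ := h.exists_dilation_bound
  have hlip : ∀ n : ℕ, LipschitzOnWith (Real.toNNReal (D * ((n : ℝ) + 2) * ((n : ℝ) + 2)))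
      φ (Icc ((n : ℝ) + 2)⁻¹ 1) := by
    intro n
    set c : ℝ := ((n : ℝ) + 2)⁻¹ with hc
    have hcpos : 0 < c := by positivity
    have hc1 : c ≤ 1 := inv_le_one_of_one_le₀ (by have := n.cast_nonneg (α := ℝ); linarith)
    have hci : c⁻¹ = n + 2 := by rw [hc, inv_inv]
    -- for `u < v` use the dilation `s = u / v`
    have key : ∀ u ∈ Icc c 1, ∀ v ∈ Icc c 1, u < v →
        |φ u - φ v| ≤ D * ((n : ℝ) + 2) * ((n : ℝ) + 2) * (v - u) := by
      intro u hu v hv huv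
      have hu0 := hcpos.trans_le hu.1
      have hv0 := hcpos.trans_le hv.1
      have h1 := hD (u / v) ⟨by positivity, (div_lt_one hv0).2 huv⟩ v ⟨hv0, hv.2⟩
      rw [div_mul_cancel₀ _ hv0.ne'] at h1
      refine h1.trans ?_
      have h2 : 1 - u / v ≤ c⁻¹ * (v - u) := by
        have : 1 - u / v = v⁻¹ * (v - u) := by field_simp
        rw [this]
        have : 0 ≤ v - u := by linarith
        have := hv.1
        gcongr
      have h3 : v ^ (-(1 / 4) : ℝ) ≤ c⁻¹ := by
        calc v ^ (-(1 / 4) : ℝ) ≤ v ^ (-1 : ℝ) :=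
              Real.rpow_le_rpow_of_exponent_ge hv0 hv.2 (by norm_num)
          _ = v⁻¹ := Real.rpow_neg_one v
          _ ≤ c⁻¹ := by have := hv.1; gcongr
      rw [hci] at h2 h3
      have : 0 ≤ v - u := by linarith
      calc _ ≤ D * (((n : ℝ) + 2) * (v - u)) * ((n : ℝ) + 2) := by gcongr
        _ = _ := by ring
    refine LipschitzOnWith.of_dist_le_mul fun u hu v hv => ?_
    rw [Real.dist_eq, Real.dist_eq, Real.coe_toNNReal _ (by positivity)]
    rcases lt_trichotomy u v with huv | huv | huv
    · have := key u hu v hv huv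
      rwa [abs_sub_comm u v, abs_of_pos (sub_pos.2 huv)]
    · simp [huv]
    · have := key v hv u hu huv
      rwa [abs_sub_comm (φ u), abs_of_pos (sub_pos.2 huv)]
  have hae : ∀ᵐ x, ∀ n : ℕ, x ∈ Icc ((n : ℝ) + 2)⁻¹ 1 →
      DifferentiableWithinAt ℝ φ (Icc ((n : ℝ) + 2)⁻¹ 1) x :=
    ae_all_iff.2 fun n => (hlip n).ae_differentiableWithinAt_of_mem_real
  filter_upwards [hae] with x hx hx01
  obtain ⟨n, hn⟩ := exists_nat_gt x⁻¹
  have hxn : ((n : ℝ) + 2)⁻¹ < x := by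
    rw [inv_lt_comm₀ (by positivity) hx01.1]; linarith
  exact (hx n ⟨hxn.le, hx01.2.le⟩).differentiableAt (Icc_mem_nhds hxn hx01.2)

lemma Q_eq_deriv {f : ℝ → ℝ} {x : ℝ} (hx : x ∈ Ioo (0 : ℝ) 1) : Q f x = x * deriv f x := by
  rw [Q, derivWithin_of_mem_nhds (Icc_mem_nhds hx.1 hx.2)]

lemma aestronglyMeasurable_Q (f : ℝ → ℝ) : AEStronglyMeasurable (Q f) unitMeasure := by
  have h1 : Measurable fun x => x * deriv f x := measurable_id.mul (measurable_deriv f)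
  refine h1.aestronglyMeasurable.congr (ae_unit_iff_Ioo.2 (ae_of_all _ fun x hx => ?_))
  exact (Q_eq_deriv hx).symm

/-- `Q φ` is the infinitesimal dilation of `φ`. -/
lemma tendsto_dilation_quotient {f : ℝ → ℝ} {x : ℝ} (hx : x ∈ Ioo (0 : ℝ) 1)
    (hf : DifferentiableAt ℝ f x) :
    Tendsto (fun s => (s - 1)⁻¹ * (f (s * x) - f x)) (𝓝[<] 1) (𝓝 (Q f x)) := by
  have h1 : HasDerivAt f (deriv f x) (1 * x) := by rw [one_mul]; exact hf.hasDerivAt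
  have h2 : HasDerivAt (fun s : ℝ => s * x) (1 * x) 1 := (hasDerivAt_id 1).mul_const x
  have h3 := h1.comp (1 : ℝ) h2
  rw [hasDerivAt_iff_tendsto_slope] at h3
  have h4 := h3.mono_left (nhdsWithin_mono _ (fun s (hs : s < 1) => hs.ne))
  rw [Q_eq_deriv hx]
  convert! h4 using 2
  · simp [slope_def_field, div_eq_inv_mul]
  · ring

lemma eventually_mem_Ioo : ∀ᶠ s : ℝ in 𝓝[<] 1, s ∈ Ioo (0 : ℝ) 1 :=
  Ioo_mem_nhdsLT one_pos

lemma abs_dilation_quotient_le {f : ℝ → ℝ} {D : ℝ}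
    (hD : ∀ s ∈ Ioo (0 : ℝ) 1, ∀ x ∈ Ioc (0 : ℝ) 1,
      |f (s * x) - f x| ≤ D * (1 - s) * x ^ (-(1 / 4) : ℝ))
    {s x : ℝ} (hs : s ∈ Ioo (0 : ℝ) 1) (hx : x ∈ Ioc (0 : ℝ) 1) :
    |(s - 1)⁻¹ * (f (s * x) - f x)| ≤ D * x ^ (-(1 / 4) : ℝ) := by
  have hs1 : 0 < 1 - s := by linarith [hs.2]
  rw [abs_mul, abs_inv, abs_sub_comm s 1, abs_of_pos hs1, inv_mul_le_iff₀ hs1]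
  refine (hD s hs x hx).trans (le_of_eq (by ring))

/-- The derivative may grow towards `0`, but `Q φ` is square-integrable. -/
lemma memLp_Q (h : IsEigenfunction φ μ) : MemLp (Q φ) 2 unitMeasure := by
  obtain ⟨D, hD0, hD⟩ := h.exists_dilation_bound
  have h1 : MemLp (fun x : ℝ => D * x ^ (-(1 / 4) : ℝ)) 2 unitMeasure := by
    refine MemLp.const_mul ?_ D
    have hm : AEStronglyMeasurable (fun x : ℝ => x ^ (-(1 / 4) : ℝ)) unitMeasure :=
      (measurable_id.pow_const _).aestronglyMeasurable
    rw [memLp_two_iff_integrable_sq hm]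
    have h2 : IntervalIntegrable (fun x : ℝ => x ^ (-(1 / 2) : ℝ)) volume 0 1 :=
      intervalIntegral.intervalIntegrable_rpow' (by norm_num)
    rw [intervalIntegrable_iff_integrableOn_Icc_of_le zero_le_one] at h2
    refine Integrable.congr h2 (ae_unit_iff_Ioo.2 (ae_of_all _ fun x hx => ?_))
    simp only
    rw [← Real.rpow_natCast, ← Real.rpow_mul hx.1.le]
    norm_num
  refine h1.mono (aestronglyMeasurable_Q φ) (ae_unit_iff_Ioo.2 ?_)
  filter_upwards [h.ae_differentiableAt] with x hx hx01
  have h3 := (tendsto_dilation_quotient hx01 (hx hx01)).abs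
  have h4 : |Q φ x| ≤ D * x ^ (-(1 / 4) : ℝ) := by
    refine le_of_tendsto h3 ?_
    filter_upwards [eventually_mem_Ioo] with s hs
    exact abs_dilation_quotient_le hD hs ⟨hx01.1, hx01.2.le⟩
  exact h4.trans (le_abs_self _)

lemma continuousWithinAt_one (h : IsEigenfunction φ μ) :
    ContinuousWithinAt φ (Iic 1) 1 := by
  obtain ⟨D, hD0, hD⟩ := h.exists_dilation_bound
  have h1 : Tendsto φ (𝓝[<] 1) (𝓝 (φ 1)) := by
    rw [tendsto_iff_norm_sub_tendsto_zero]
    have h2 : Tendsto (fun s : ℝ => D * (1 - s)) (𝓝[<] 1) (𝓝 0) := by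
      have : Continuous fun s : ℝ => D * (1 - s) := by fun_prop
      simpa using (this.tendsto 1).mono_left nhdsWithin_le_nhds
    refine squeeze_zero' (Eventually.of_forall fun _ => norm_nonneg _) ?_ h2
    filter_upwards [eventually_mem_Ioo] with s hs
    simpa using hD s hs 1 (by simp)
  rw [← continuousWithinAt_Iio_iff_Iic]
  exact h1

lemma tendsto_average_K_mul (h : IsEigenfunction φ μ) {x : ℝ} (hx : 0 < x)
    (hj : x⁻¹ ∉ range ((↑) : ℤ → ℝ)) :
    Tendsto (fun s => (1 - s)⁻¹ * ∫ u in s..1, K x u * φ u) (𝓝[<] 1) (𝓝 (K x 1 * φ 1)) := by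
  have hi := intervalIntegrable_K_mul h.intervalIntegrable x
  have hK : ContinuousAt (K x) 1 := by
    have := continuousAt_K_left (x := 1) (y := x) one_pos hx (by rwa [one_mul])
    simpa only [K_comm _ x] using this
  have hcont : ContinuousWithinAt (fun u => K x u * φ u) (Iic 1) 1 :=
    hK.continuousWithinAt.mul h.continuousWithinAt_one
  have hmeas : StronglyMeasurableAtFilter (fun u => K x u * φ u) (𝓝[Iic 1] 1) volume :=
    ⟨Ioc 0 1, Ioc_mem_nhdsLE one_pos, hi.1.aestronglyMeasurable⟩
  have hd := intervalIntegral.integral_hasDerivWithinAt_right (s := Iic 1) (t := Iic 1) hi hmeas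
    hcont
  rw [hasDerivWithinAt_iff_tendsto_slope] at hd
  have hset : Iic (1 : ℝ) \ {1} = Iio 1 := by ext; simp [lt_iff_le_and_ne]
  rw [hset] at hd
  refine hd.congr' ?_
  filter_upwards [eventually_mem_Ioo] with s hs
  have hadd : (∫ u in (0 : ℝ)..s, K x u * φ u) + ∫ u in s..1, K x u * φ u
      = ∫ u in (0 : ℝ)..1, K x u * φ u :=
    intervalIntegral.integral_add_adjacent_intervals
      (intervalIntegrable_K_mul (h.intervalIntegrable_of_mem (by simp) ⟨hs.1.le, hs.2.le⟩) x)
      (intervalIntegrable_K_mul (h.intervalIntegrable_of_mem ⟨hs.1.le, hs.2.le⟩ (by simp)) x)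
  have hne : s - 1 ≠ 0 := by linarith [hs.2]
  have hne' : 1 - s ≠ 0 := by linarith [hs.2]
  rw [slope_def_field, ← hadd]
  field_simp
  ring

/-- The differentiated eigenvalue equation, obtained from `sub_comp_mul_eq` by dividing by `s - 1`
and letting `s` tend to `1`. -/
lemma Q_eq (h : IsEigenfunction φ μ) : ∀ᵐ x ∂unitMeasure,
    Q φ x = μ * φ 1 * K x 1 - φ x - μ * ∫ y in (0 : ℝ)..1, K x y * Q φ y := by
  obtain ⟨D, hD0, hD⟩ := h.exists_dilation_bound
  rw [ae_unit_iff_Ioo]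
  filter_upwards [h.ae_differentiableAt, ae_not_jump one_pos] with x hdiff hjump hx
  rw [one_mul] at hjump
  -- the difference quotient, dominated by an integrable power uniformly in `s`
  set R : ℝ → ℝ → ℝ := fun s y => (s - 1)⁻¹ * (φ (s * y) - φ y) with hR
  have hRi : ∀ s ∈ Ioo (0 : ℝ) 1, IntervalIntegrable (R s) volume 0 1 := fun s hs =>
    ((h.intervalIntegrable_comp_mul hs).sub h.intervalIntegrable).const_mul _
  have hlim1 : Tendsto (fun s => R s x) (𝓝[<] 1) (𝓝 (Q φ x)) :=
    tendsto_dilation_quotient hx (hdiff hx)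
  have hlim2 : Tendsto (fun s => ∫ y in (0 : ℝ)..1, K (s * x) y * R s y) (𝓝[<] 1)
      (𝓝 (∫ y in (0 : ℝ)..1, K x y * Q φ y)) := by
    have hb : IntervalIntegrable (fun y : ℝ => D * y ^ (-(1 / 4) : ℝ)) volume 0 1 :=
      (intervalIntegral.intervalIntegrable_rpow' (by norm_num)).const_mul D
    refine intervalIntegral.tendsto_integral_filter_of_dominated_convergence
      (fun y => D * y ^ (-(1 / 4) : ℝ)) ?_ ?_ hb ?_
    · filter_upwards [eventually_mem_Ioo] with s hs
      rw [uIoc_of_le zero_le_one]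
      exact (intervalIntegrable_K_mul (hRi s hs) _).1.aestronglyMeasurable
    · filter_upwards [eventually_mem_Ioo] with s hs
      refine ae_of_all _ fun y hy => ?_
      rw [uIoc_of_le zero_le_one] at hy
      have h1 := abs_dilation_quotient_le hD hs hy
      have h2 := abs_K_le (s * x) y
      rw [norm_mul, Real.norm_eq_abs, Real.norm_eq_abs]
      have h3 := abs_nonneg (R s y)
      have h4 : |R s y| ≤ D * y ^ (-(1 / 4) : ℝ) := h1
      nlinarith
    · have hne : ∀ᵐ y : ℝ, y ≠ 1 := by simp [ae_iff, measure_singleton]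
      filter_upwards [h.ae_differentiableAt, ae_not_jump hx.1, hne] with y hy hyj hy1 hmem
      rw [uIoc_of_le zero_le_one] at hmem
      have hy01 : y ∈ Ioo (0 : ℝ) 1 := ⟨hmem.1, lt_of_le_of_ne hmem.2 hy1⟩
      refine Tendsto.mul ?_ (tendsto_dilation_quotient hy01 (hy hy01))
      have h1 : Tendsto (fun s : ℝ => s * x) (𝓝[<] 1) (𝓝 x) := by
        have : Continuous fun s : ℝ => s * x := by fun_prop
        simpa using (this.tendsto 1).mono_left nhdsWithin_le_nhds
      exact (continuousAt_K_left hx.1 hmem.1 hyj).tendsto.comp h1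
  have hinv : Tendsto (fun s : ℝ => s⁻¹) (𝓝[<] 1) (𝓝 1) := by
    have := (tendsto_inv₀ (one_ne_zero (α := ℝ))).mono_left
      (nhdsWithin_le_nhds (s := Iio (1 : ℝ)))
    simpa using this
  have hlim3 := ((hinv.mul_const (φ x)).neg.add ((hinv.const_mul μ).mul
    (h.tendsto_average_K_mul hx.1 hjump))).sub (hlim2.const_mul μ)
  have heq : ∀ᶠ s in 𝓝[<] (1 : ℝ), -(s⁻¹ * φ x) + μ * s⁻¹ *
      ((1 - s)⁻¹ * ∫ u in s..1, K x u * φ u) - μ * ∫ y in (0 : ℝ)..1, K (s * x) y * R s y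
      = R s x := by
    filter_upwards [eventually_mem_Ioo] with s hs
    have h1 := h.sub_comp_mul_eq hs ⟨hx.1, hx.2.le⟩
    have h2 : ∫ y in (0 : ℝ)..1, K (s * x) y * R s y
        = (s - 1)⁻¹ * ∫ y in (0 : ℝ)..1, K (s * x) y * (φ (s * y) - φ y) := by
      rw [← intervalIntegral.integral_const_mul]
      refine intervalIntegral.integral_congr fun y _ => ?_
      simp only [hR]; ring
    have hne : s - 1 ≠ 0 := by linarith [hs.2]
    have hs0 : s ≠ 0 := hs.1.ne'
    have hi : (1 - s)⁻¹ = -(s - 1)⁻¹ := by rw [← neg_sub, inv_neg]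
    simp only [hR]
    rw [h1]
    change _ - μ * (∫ y in (0 : ℝ)..1, K (s * x) y * R s y) = _
    rw [h2, hi]
    field_simp
    ring
  have := tendsto_nhds_unique hlim1 (hlim3.congr' heq)
  rw [this]
  ring

end IsEigenfunction

open scoped RealInnerProductSpace

/-! ### Compact operators and orthogonal expansions -/

section Abstract

/-- Pairing with a square-integrable vector-valued function `k` gives a compact operator into
`L²`: for a simple function `k` it has finite rank, and simple functions are dense. -/
lemma isCompactOperator_compLpL₂_flip {α : Type*} [MeasurableSpace α] {ν : Measure α}
    {E F : Type*} [NormedAddCommGroup E] [NormedSpace ℝ E] [NormedAddCommGroup F]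
    [NormedSpace ℝ F] (B : E →L[ℝ] F →L[ℝ] ℝ) (k : Lp F 2 ν) :
    IsCompactOperator ((B.compLpL₂ 2 ν).flip k) := by
  refine Lp.induction (p := 2) (by norm_num)
    (motive := fun k => IsCompactOperator ((B.compLpL₂ 2 ν).flip k)) ?_ ?_ ?_ k
  · intro c s hs hμs
    have h1 : (B.compLpL₂ 2 ν).flip (Lp.simpleFunc.indicatorConst 2 hs hμs.ne c : Lp F 2 ν)
        = ((ContinuousLinearMap.id ℝ ℝ).smulRight (indicatorConstLp 2 hs hμs.ne (1 : ℝ))).comp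
          (B.flip c) := by
      ext1 e
      rw [Lp.simpleFunc.coe_indicatorConst]
      simp only [ContinuousLinearMap.flip_apply, ContinuousLinearMap.compLpL₂_apply_apply,
        ContinuousLinearMap.comp_apply, ContinuousLinearMap.smulRight_apply,
        ContinuousLinearMap.id_apply]
      ext1
      filter_upwards [(B e).coeFn_compLp (indicatorConstLp 2 hs hμs.ne c),
        indicatorConstLp_coeFn (p := 2) (hs := hs) (hμs := hμs.ne) (c := c),
        indicatorConstLp_coeFn (p := 2) (hs := hs) (hμs := hμs.ne) (c := (1 : ℝ)),
        Lp.coeFn_smul (B e c) (indicatorConstLp 2 hs hμs.ne (1 : ℝ))] with x h1 h2 h3 h4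
      rw [h1, h2, h4, Pi.smul_apply, h3]
      by_cases hx : x ∈ s <;> simp [hx]
    rw [h1]
    have h2 : IsCompactOperator (B.flip c) := isCompactOperator_of_locallyCompactSpace_dom _
    exact h2.clm_comp ((ContinuousLinearMap.id ℝ ℝ).smulRight
      (indicatorConstLp 2 hs hμs.ne (1 : ℝ)))
  · intro f g hf hg _ h1 h2
    rw [map_add]
    exact h1.add h2
  · exact isClosed_setOfPred_isCompactOperator.preimage
      (B.compLpL₂ 2 ν).flip.continuous

variable {H : Type*} [NormedAddCommGroup H] [InnerProductSpace ℝ H]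

/-- A compact symmetric operator vanishes on an invariant closed subspace in which it has no
eigenvector with nonzero eigenvalue. -/
lemma apply_eq_zero_of_no_eigenvector {T : H →L[ℝ] H} (hc : IsCompactOperator T)
    (hs : (T : H →ₗ[ℝ] H).IsSymmetric) (V : Submodule ℝ H) [CompleteSpace V]
    (hV : ∀ v ∈ V, T v ∈ V) (hne : ∀ v ∈ V, ∀ κ : ℝ, κ ≠ 0 → T v = κ • v → v = 0)
    {v : H} (hv : v ∈ V) : T v = 0 := by
  have hSc : IsCompactOperator (T.restrict hV) := hc.restrict' (f := (T : H →ₗ[ℝ] H)) hV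
  have hSs : (T.restrict hV : V →ₗ[ℝ] V).IsSymmetric := hs.restrict_invariant hV
  have hS : T.restrict hV = 0 := by
    rw [← ContinuousLinearMap.eq_zero_of_forall_hasEigenvalue_eq_zero hSc hSs]
    intro κ hκ
    by_contra hκ0
    obtain ⟨w, hw⟩ := hκ.exists_hasEigenvector
    have h1 : T (w : H) = κ • (w : H) := congrArg Subtype.val hw.apply_eq_smul
    exact hw.2 (Subtype.ext (hne w w.2 κ hκ0 h1))
  have := congrArg (fun S : V →L[ℝ] V => ((S ⟨v, hv⟩ : V) : H)) hS
  simpa using this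

/-- A vector orthogonal to everything that is orthogonal to an orthonormal sequence is the sum of
its expansion. -/
lemma tendsto_orthonormal_expansion [CompleteSpace H] {e : ℕ → H} (he : Orthonormal ℝ e) {q : H}
    (hq : ∀ g : H, (∀ h, ⟪e h, g⟫ = 0) → ⟪q, g⟫ = 0) :
    Tendsto (fun N => ∑ h ∈ Finset.range N, ⟪q, e h⟫ • e h) atTop (𝓝 q) := by
  have hsum : Summable fun h => ⟪e h, q⟫ • e h := by
    have h1 := (he.orthogonalFamily.summable_iff_norm_sq_summable fun h => ⟪e h, q⟫).2
      (he.inner_products_summable q)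
    simpa using h1
  obtain ⟨s, hs⟩ := hsum
  have hes : ∀ k, ⟪e k, s⟫ = ⟪e k, q⟫ := by
    intro k
    have h1 := (innerSL ℝ (e k)).hasSum hs
    simp only [innerSL_apply_apply, inner_smul_right] at h1
    have h2 : HasSum (fun h => ⟪e h, q⟫ * ⟪e k, e h⟫) (⟪e k, q⟫ * ⟪e k, e k⟫) :=
      hasSum_single k fun h hh => by rw [he.2 hh.symm, mul_zero]
    rw [h1.unique h2, real_inner_self_eq_norm_sq, he.1 k]
    simp
  have horth : ∀ k, ⟪e k, q - s⟫ = 0 := fun k => by rw [inner_sub_right, hes, sub_self]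
  have hqr := hq _ horth
  have hsr : ⟪s, q - s⟫ = 0 := by
    have h1 := (innerSL ℝ (q - s)).hasSum hs
    simp only [innerSL_apply_apply, inner_smul_right, real_inner_comm, horth, mul_zero] at h1
    exact h1.unique hasSum_zero
  have h0 : q - s = 0 := by
    rw [← inner_self_eq_zero (𝕜 := ℝ), inner_sub_left, hqr, hsr, sub_zero]
  have h2 := hs.tendsto_sum_nat
  rw [← sub_eq_zero.1 h0] at h2
  simpa only [real_inner_comm] using h2

end Abstract

/-! ### The integral operator on `L²` -/

/-- The Hilbert space `L²([0,1])`. -/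
noncomputable abbrev L2 : Type := Lp ℝ 2 unitMeasure

lemma inner_toLp {f g : ℝ → ℝ} (hf : MemLp f 2 unitMeasure) (hg : MemLp g 2 unitMeasure) :
    ⟪hf.toLp f, hg.toLp g⟫ = ip f g := by
  rw [L2.inner_def, ip, intervalIntegral_eq_unit]
  refine integral_congr_ae ?_
  filter_upwards [hf.coeFn_toLp, hg.coeFn_toLp] with x h1 h2
  simp [h1, h2, mul_comm]

lemma norm_toLp_sq {f : ℝ → ℝ} (hf : MemLp f 2 unitMeasure) :
    ‖hf.toLp f‖ ^ 2 = ∫ x in (0 : ℝ)..1, f x ^ 2 := by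
  rw [← real_inner_self_eq_norm_sq, inner_toLp, ip]
  simp only [sq]

lemma memLp_K (x : ℝ) : MemLp (K x) 2 unitMeasure :=
  MemLp.of_bound (measurable_K_right x).aestronglyMeasurable (1 / 2)
    (ae_of_all _ fun y => abs_K_le x y)

/-- The section `K(x, ·)` as an element of `L²([0,1])`. -/
noncomputable def kernelSection (x : ℝ) : L2 := (memLp_K x).toLp (K x)

lemma inner_kernelSection (x : ℝ) (f : L2) :
    ⟪kernelSection x, f⟫ = ∫ y in (0 : ℝ)..1, K x y * f y := by
  have h := inner_toLp (memLp_K x) (Lp.memLp f)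
  rwa [Lp.toLp_coeFn] at h

lemma continuousOn_kernelSection : ContinuousOn kernelSection (Ioi 0) := by
  intro x hx
  apply ContinuousAt.continuousWithinAt
  rw [ContinuousAt, tendsto_iff_norm_sub_tendsto_zero]
  have hsq : ∀ t, ‖kernelSection t - kernelSection x‖ ^ 2
      = ∫ y in (0 : ℝ)..1, (K t y - K x y) ^ 2 := fun t => by
    rw [kernelSection, kernelSection, ← MemLp.toLp_sub, norm_toLp_sq]
    rfl
  have hlim : Tendsto (fun t => ∫ y in (0 : ℝ)..1, (K t y - K x y) ^ 2) (𝓝 x)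
      (𝓝 (∫ y in (0 : ℝ)..1, (K x y - K x y) ^ 2)) := by
    refine intervalIntegral.tendsto_integral_filter_of_dominated_convergence (fun _ => 1) ?_ ?_
      intervalIntegrable_const ?_
    · exact Eventually.of_forall fun t =>
        (((measurable_K_right t).sub (measurable_K_right x)).pow_const 2).aestronglyMeasurable
    · refine Eventually.of_forall fun t => ae_of_all _ fun y _ => ?_
      have h1 := abs_le.1 (abs_K_le t y)
      have h2 := abs_le.1 (abs_K_le x y)
      rw [Real.norm_of_nonneg (sq_nonneg _)]
      nlinarith
    · filter_upwards [ae_not_jump hx] with y hy hmem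
      rw [uIoc_of_le zero_le_one] at hmem
      exact ((continuousAt_K_left hx hmem.1 hy).tendsto.sub_const _).pow 2
  simp only [sub_self, ne_eq, OfNat.ofNat_ne_zero, not_false_eq_true, zero_pow,
    intervalIntegral.integral_zero] at hlim
  have h3 := hlim.sqrt
  simp only [← hsq, Real.sqrt_sq (norm_nonneg _), Real.sqrt_zero] at h3
  exact h3

lemma memLp_kernelSection : MemLp kernelSection 2 unitMeasure := by
  refine MemLp.of_bound ?_ 1 (ae_of_all _ fun x => ?_)
  · have h1 : AEStronglyMeasurable kernelSection (volume.restrict (Ioo (0 : ℝ) 1)) :=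
      (continuousOn_kernelSection.mono fun x hx => hx.1).aestronglyMeasurable measurableSet_Ioo
    exact h1.mono_measure restrict_Ioo_eq_restrict_Icc.ge
  · have h1 : ‖kernelSection x‖ ^ 2 ≤ 1 := by
      rw [kernelSection, norm_toLp_sq]
      have h2 := intervalIntegral.norm_integral_le_of_norm_le_const (a := (0 : ℝ)) (b := 1)
        (C := 1) (f := fun y => K x y ^ 2) (fun y _ => by
          have h1 := abs_le.1 (abs_K_le x y)
          rw [Real.norm_of_nonneg (sq_nonneg _)]
          nlinarith)
      have h3 := (le_abs_self _).trans h2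
      simpa using h3
    nlinarith [norm_nonneg (kernelSection x)]

/-- The integral operator `f ↦ ∫₀¹ K(·, y) f(y) dy` on `L²([0,1])`, built as the pairing with the
square-integrable `L²`-valued function `x ↦ K(x, ·)`. -/
noncomputable def integralOperator : L2 →L[ℝ] L2 :=
  ((isBoundedBilinearMap_inner (𝕜 := ℝ) (E := L2)).toContinuousLinearMap.compLpL₂ 2
    unitMeasure).flip (memLp_kernelSection.toLp kernelSection)

lemma isCompactOperator_integralOperator : IsCompactOperator integralOperator :=
  isCompactOperator_compLpL₂_flip _ _

lemma integralOperator_apply_ae (f : L2) :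
    integralOperator f =ᵐ[unitMeasure] fun x => ∫ y in (0 : ℝ)..1, K x y * f y := by
  have h1 := ((isBoundedBilinearMap_inner (𝕜 := ℝ) (E := L2)).toContinuousLinearMap f).coeFn_compLp
    (memLp_kernelSection.toLp kernelSection)
  filter_upwards [h1, memLp_kernelSection.coeFn_toLp] with x h1 h2
  refine h1.trans ?_
  rw [h2, ← inner_kernelSection, real_inner_comm]
  rfl

lemma integral_K_mul_congr {f g : ℝ → ℝ} (h : f =ᵐ[unitMeasure] g) (x : ℝ) :
    ∫ y in (0 : ℝ)..1, K x y * f y = ∫ y in (0 : ℝ)..1, K x y * g y := by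
  rw [intervalIntegral_eq_unit, intervalIntegral_eq_unit]
  refine integral_congr_ae ?_
  filter_upwards [h] with y hy
  rw [hy]

lemma integralOperator_toLp_ae {f : ℝ → ℝ} (hf : MemLp f 2 unitMeasure) :
    integralOperator (hf.toLp f) =ᵐ[unitMeasure] fun x => ∫ y in (0 : ℝ)..1, K x y * f y := by
  filter_upwards [integralOperator_apply_ae (hf.toLp f)] with x hx
  rw [hx, integral_K_mul_congr hf.coeFn_toLp]

lemma isSymmetric_integralOperator : (integralOperator : L2 →ₗ[ℝ] L2).IsSymmetric := by
  intro f g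
  have hf : Integrable f unitMeasure := (Lp.memLp f).integrable one_le_two
  have hg : Integrable g unitMeasure := (Lp.memLp g).integrable one_le_two
  have h1 : ⟪integralOperator f, g⟫ = ∫ x, ∫ y, K x y * (f y * g x) ∂unitMeasure ∂unitMeasure := by
    rw [L2.inner_def]
    refine integral_congr_ae ?_
    filter_upwards [integralOperator_apply_ae f] with x hx
    rw [hx, intervalIntegral_eq_unit]
    simp only [RCLike.inner_apply, conj_trivial, ← mul_assoc, integral_mul_const]
    rw [mul_comm]
  have h2 : ⟪f, integralOperator g⟫ = ∫ y, ∫ x, K x y * (f y * g x) ∂unitMeasure ∂unitMeasure := by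
    rw [L2.inner_def]
    refine integral_congr_ae ?_
    filter_upwards [integralOperator_apply_ae g] with y hy
    rw [hy, intervalIntegral_eq_unit]
    simp only [RCLike.inner_apply, conj_trivial, K_comm y]
    rw [← integral_mul_const]
    refine integral_congr_ae (ae_of_all _ fun x => ?_)
    simp only
    ring
  change ⟪integralOperator f, g⟫ = ⟪f, integralOperator g⟫
  rw [h1, h2]
  refine integral_integral_swap ?_
  have h3 : Integrable (fun p : ℝ × ℝ => f p.2 * g p.1) (unitMeasure.prod unitMeasure) := by
    have := hg.mul_prod hf
    refine this.congr (ae_of_all _ fun p => mul_comm _ _)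
  exact h3.bdd_mul (c := 1 / 2) (f := fun p : ℝ × ℝ => K p.1 p.2)
    measurable_uncurry_K.aestronglyMeasurable (ae_of_all _ fun p => abs_K_le p.1 p.2)

/-! ### Maximal systems of eigenfunctions -/

lemma IsEigenfunction.integralOperator_toLp {φ : ℝ → ℝ} {μ : ℝ} (h : IsEigenfunction φ μ) :
    integralOperator (h.memLp.toLp φ) = μ⁻¹ • h.memLp.toLp φ := by
  ext1
  filter_upwards [integralOperator_toLp_ae h.memLp, h.memLp.coeFn_toLp,
    Lp.coeFn_smul μ⁻¹ (h.memLp.toLp φ), ae_restrict_mem measurableSet_Icc] with x h1 h2 h3 hx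
  rw [h1, h3, Pi.smul_apply, h2, h.eq x hx, smul_eq_mul, inv_mul_cancel_left₀ h.eigenvalue_ne_zero]

/-- An eigenvector of the integral operator is represented by an eigenfunction, for which the
eigenvalue equation holds at every point. -/
lemma exists_isEigenfunction {v : L2} {κ : ℝ} (hκ : κ ≠ 0) (hv : v ≠ 0)
    (hT : integralOperator v = κ • v) :
    ∃ ψ : ℝ → ℝ, IsEigenfunction ψ κ⁻¹ ∧ ψ =ᵐ[unitMeasure] v := by
  set ψ : ℝ → ℝ := fun x => κ⁻¹ * ∫ y in (0 : ℝ)..1, K x y * v y with hψ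
  have hae : ψ =ᵐ[unitMeasure] v := by
    have h1 := integralOperator_apply_ae v
    rw [hT] at h1
    filter_upwards [h1, Lp.coeFn_smul κ v] with x h1 h2
    rw [h2, Pi.smul_apply, smul_eq_mul] at h1
    simp only [hψ]
    rw [← h1, inv_mul_cancel_left₀ hκ]
  have hmem : MemLp ψ 2 unitMeasure := (memLp_congr_ae hae).2 (Lp.memLp v)
  have hto : hmem.toLp ψ = v := by
    ext1
    exact hmem.coeFn_toLp.trans hae
  refine ⟨ψ, ⟨hmem, ?_, fun x _ => ?_⟩, hae⟩
  · rw [← inner_toLp hmem hmem, hto]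
    exact real_inner_self_pos.2 hv
  · rw [integral_K_mul_congr hae]

/-- The section `K(1, ·)` is orthogonal to the null space of the operator, because it is a limit
of sections `K(x, ·)` with `x < 1`. -/
lemma inner_kernelSection_one_eq_zero {g : L2} (hg : integralOperator g = 0) :
    ⟪kernelSection 1, g⟫ = 0 := by
  have h1 : (fun x => ⟪kernelSection x, g⟫) =ᵐ[volume.restrict (Ioc (0 : ℝ) 1)] fun _ => 0 := by
    refine ae_restrict_of_ae_restrict_of_subset Ioc_subset_Icc_self ?_
    have h2 := integralOperator_apply_ae g
    rw [hg] at h2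
    filter_upwards [h2, Lp.coeFn_zero ℝ 2 unitMeasure] with x h2 h3
    rw [inner_kernelSection, ← h2, h3, Pi.zero_apply]
  have hcont : ContinuousOn (fun x => ⟪kernelSection x, g⟫) (Ioc 0 1) :=
    (continuousOn_kernelSection.mono fun x hx => hx.1).inner continuousOn_const
  exact Measure.eqOn_Ioc_of_ae_eq volume h1 hcont continuousOn_const ⟨one_pos, le_rfl⟩

namespace IsMaximalEigensystem

variable {φ : ℕ → ℝ → ℝ} {ev : ℕ → ℝ}

/-- The members of the system as elements of `L²([0,1])`. -/
noncomputable def vec (hsys : IsMaximalEigensystem φ ev) (h : ℕ) : L2 :=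
  (hsys.eigen h).memLp.toLp (φ h)

lemma orthonormal_vec (hsys : IsMaximalEigensystem φ ev) : Orthonormal ℝ hsys.vec := by
  rw [orthonormal_iff_ite]
  intro h k
  rw [vec, vec, inner_toLp, hsys.orthonormal]

lemma integralOperator_vec (hsys : IsMaximalEigensystem φ ev) (h : ℕ) :
    integralOperator (hsys.vec h) = (ev h)⁻¹ • hsys.vec h :=
  (hsys.eigen h).integralOperator_toLp

/-- By maximality and the spectral theorem, the operator vanishes on the orthogonal complement of
the system. -/
lemma integralOperator_eq_zero (hsys : IsMaximalEigensystem φ ev) {g : L2}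
    (hg : ∀ h, ⟪hsys.vec h, g⟫ = 0) : integralOperator g = 0 := by
  set V : Submodule ℝ L2 := (Submodule.span ℝ (range hsys.vec))ᗮ with hVdef
  have hmem : ∀ v : L2, v ∈ V ↔ ∀ h, ⟪hsys.vec h, v⟫ = 0 := by
    intro v
    rw [hVdef, Submodule.mem_orthogonal]
    refine ⟨fun hv h => hv _ (Submodule.subset_span ⟨h, rfl⟩), fun hv u hu => ?_⟩
    induction hu using Submodule.span_induction with
    | mem x hx => obtain ⟨h, rfl⟩ := hx; exact hv h
    | zero => exact inner_zero_left _
    | add x y _ _ hx hy => rw [inner_add_left, hx, hy, add_zero]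
    | smul c x _ hx => rw [real_inner_smul_left, hx, mul_zero]
  refine apply_eq_zero_of_no_eigenvector isCompactOperator_integralOperator
    isSymmetric_integralOperator V ?_ ?_ ((hmem g).2 hg)
  · intro v hv
    rw [hmem] at hv ⊢
    intro h
    have h1 : ⟪integralOperator (hsys.vec h), v⟫ = ⟪hsys.vec h, integralOperator v⟫ :=
      isSymmetric_integralOperator _ _
    rw [← h1, integralOperator_vec, real_inner_smul_left, hv, mul_zero]
  · intro v hv κ hκ hT
    by_contra hv0
    obtain ⟨ψ, hψ, hae⟩ := exists_isEigenfunction hκ hv0 hT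
    refine hsys.maximal ⟨ψ, κ⁻¹, hψ, fun h => ?_⟩
    have hto : hψ.memLp.toLp ψ = v := by
      ext1
      exact hψ.memLp.coeFn_toLp.trans hae
    rw [← inner_toLp hψ.memLp (hsys.eigen h).memLp, hto, real_inner_comm]
    exact (hmem v).1 hv h

/-- Mean convergence of the expansion, in terms of functions. -/
lemma tendsto_expansion (hsys : IsMaximalEigensystem φ ev) {q : ℝ → ℝ}
    (hq : MemLp q 2 unitMeasure)
    (horth : ∀ g : L2, (∀ h, ⟪hsys.vec h, g⟫ = 0) → ⟪hq.toLp q, g⟫ = 0) :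
    Tendsto (fun H : ℕ => ∫ x in (0 : ℝ)..1,
      (q x - ∑ h ∈ Finset.range H, ip q (φ h) * φ h x) ^ 2) atTop (𝓝 0) := by
  have h1 := tendsto_orthonormal_expansion hsys.orthonormal_vec horth
  have h2 := (tendsto_const_nhds (x := hq.toLp q)).sub h1
  rw [sub_self] at h2
  have h3 := h2.norm.pow 2
  rw [norm_zero, zero_pow two_ne_zero] at h3
  refine h3.congr fun H => ?_
  have hS : MemLp (fun x => ∑ h ∈ Finset.range H, ip q (φ h) * φ h x) 2 unitMeasure :=
    memLp_finsetSum _ fun h _ => (hsys.eigen h).memLp.const_mul _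
  have h4 : ∑ h ∈ Finset.range H, ⟪hq.toLp q, hsys.vec h⟫ • hsys.vec h = hS.toLp _ := by
    ext1
    refine EventuallyEq.trans ?_ hS.coeFn_toLp.symm
    refine (Lp.coeFn_finsetSum _ _).trans ?_
    have h5 : ∀ᵐ x ∂unitMeasure, ∀ h, (⟪hq.toLp q, hsys.vec h⟫ • hsys.vec h : L2) x
        = ip q (φ h) * φ h x := by
      refine ae_all_iff.2 fun h => ?_
      filter_upwards [Lp.coeFn_smul ⟪hq.toLp q, hsys.vec h⟫ (hsys.vec h),
        (hsys.eigen h).memLp.coeFn_toLp] with x h6 h7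
      rw [h6, Pi.smul_apply, smul_eq_mul, vec, inner_toLp, h7]
    filter_upwards [h5] with x hx
    rw [Finset.sum_apply]
    exact Finset.sum_congr rfl fun h _ => hx h
  rw [h4, ← MemLp.toLp_sub, norm_toLp_sq]
  rfl

end IsMaximalEigensystem

/-- The function `P` represents `-μ T Q`. -/
lemma IsEigenfunction.P_ae_eq {f : ℝ → ℝ} {μ : ℝ} (h : IsEigenfunction f μ) :
    P f μ =ᵐ[unitMeasure] ((-μ) • integralOperator (h.memLp_Q.toLp (Q f)) : L2) := by
  filter_upwards [integralOperator_toLp_ae h.memLp_Q,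
    Lp.coeFn_smul (-μ) (integralOperator (h.memLp_Q.toLp (Q f)))] with x h1 h2
  rw [h2, Pi.smul_apply, h1, P, smul_eq_mul]

lemma IsEigenfunction.memLp_P {f : ℝ → ℝ} {μ : ℝ} (h : IsEigenfunction f μ) :
    MemLp (P f μ) 2 unitMeasure :=
  (memLp_congr_ae h.P_ae_eq).2 (Lp.memLp _)

lemma IsEigenfunction.toLp_P {f : ℝ → ℝ} {μ : ℝ} (h : IsEigenfunction f μ) :
    h.memLp_P.toLp (P f μ) = (-μ) • integralOperator (h.memLp_Q.toLp (Q f)) := by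
  ext1
  exact h.memLp_P.coeFn_toLp.trans h.P_ae_eq

/-- The differentiated eigenvalue equation as an identity in `L²([0,1])`. -/
lemma IsEigenfunction.toLp_Q {f : ℝ → ℝ} {μ : ℝ} (h : IsEigenfunction f μ) :
    h.memLp_Q.toLp (Q f) = (μ * f 1) • kernelSection 1 - h.memLp.toLp f
      + h.memLp_P.toLp (P f μ) := by
  have h1 : MemLp (fun x => μ * f 1 * K 1 x) 2 unitMeasure := (memLp_K 1).const_mul _
  have h2 : (μ * f 1) • kernelSection 1 = h1.toLp _ := rfl
  rw [h2, ← MemLp.toLp_sub, ← MemLp.toLp_add]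
  refine MemLp.toLp_congr _ _ ?_
  filter_upwards [h.Q_eq] with x hx
  rw [hx, K_comm x 1]
  simp only [Pi.add_apply, Pi.sub_apply, P]
  ring

end MertensKernel

open scoped RealInnerProductSpace in
theorem corollary4p18 (φ : ℕ → ℝ → ℝ) (ev : ℕ → ℝ)
    (hsys : MertensKernel.IsMaximalEigensystem φ ev) (j : ℕ)
    (P Q : ℝ → ℝ) (hP : P = MertensKernel.P (φ j) (ev j)) (hQ : Q = MertensKernel.Q (φ j))
    (a b : ℕ → ℝ) (ha : ∀ h, a h = MertensKernel.ip P (φ h))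
    (hb : ∀ h, b h = MertensKernel.ip Q (φ h)) :
    (∀ᵐ x ∂MertensKernel.unitMeasure, DifferentiableWithinAt ℝ (φ j) (Icc 0 1) x) ∧
    MemLp P 2 MertensKernel.unitMeasure ∧
    MemLp Q 2 MertensKernel.unitMeasure ∧
    Tendsto (fun H : ℕ => ∫ x in (0 : ℝ)..1, (P x - ∑ h ∈ Finset.range H, a h * φ h x) ^ 2)
      atTop (𝓝 0) ∧
    Tendsto (fun H : ℕ => ∫ x in (0 : ℝ)..1, (Q x - ∑ h ∈ Finset.range H, b h * φ h x) ^ 2)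
      atTop (𝓝 0) ∧
    ∀ h : ℕ,
      -(ev h / ev j) * (1 + ev h / ev j) * a h = (1 + ev h / ev j) * b h ∧
      (1 + ev h / ev j) * b h = φ j 1 * φ h 1 - MertensKernel.ip (φ j) (φ h) := by
  subst hP hQ
  have hj := hsys.eigen j
  have hTQ : ∀ g : MertensKernel.L2, ⟪hj.memLp_P.toLp _, g⟫
      = -ev j * ⟪hj.memLp_Q.toLp _, MertensKernel.integralOperator g⟫ := fun g => by
    rw [hj.toLp_P, real_inner_smul_left]
    congr 1
    exact MertensKernel.isSymmetric_integralOperator _ _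
  have hPorth : ∀ g : MertensKernel.L2, (∀ h, ⟪hsys.vec h, g⟫ = 0) →
      ⟪hj.memLp_P.toLp _, g⟫ = 0 := fun g hg => by
    rw [hTQ, hsys.integralOperator_eq_zero hg, inner_zero_right, mul_zero]
  have hQorth : ∀ g : MertensKernel.L2, (∀ h, ⟪hsys.vec h, g⟫ = 0) →
      ⟪hj.memLp_Q.toLp _, g⟫ = 0 := fun g hg => by
    have h1 : ⟪hj.memLp.toLp (φ j), g⟫ = 0 := hg j
    rw [hj.toLp_Q, inner_add_left, inner_sub_left, real_inner_smul_left, hPorth g hg, h1,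
      MertensKernel.inner_kernelSection_one_eq_zero
        (hsys.integralOperator_eq_zero hg)]
    simp
  refine ⟨?_, hj.memLp_P, hj.memLp_Q, ?_, ?_, fun h => ?_⟩
  · rw [MertensKernel.ae_unit_iff_Ioo]
    filter_upwards [hj.ae_differentiableAt] with x hx hmem
    exact (hx hmem).differentiableWithinAt
  · simp only [ha]
    exact hsys.tendsto_expansion hj.memLp_P hPorth
  · simp only [hb]
    exact hsys.tendsto_expansion hj.memLp_Q hQorth
  · have hh := hsys.eigen h
    have hne := hh.eigenvalue_ne_zero
    have hnej := hj.eigenvalue_ne_zero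
    have ha' : a h = ⟪hj.memLp_P.toLp _, hsys.vec h⟫ := by
      rw [ha, MertensKernel.IsMaximalEigensystem.vec, MertensKernel.inner_toLp]
    have hb' : b h = ⟪hj.memLp_Q.toLp _, hsys.vec h⟫ := by
      rw [hb, MertensKernel.IsMaximalEigensystem.vec, MertensKernel.inner_toLp]
    have hab : a h = -(ev j / ev h) * b h := by
      rw [ha', hb', hTQ, hsys.integralOperator_vec, real_inner_smul_right]
      field_simp
    -- the eigenvalue equation for `φ h` at the point `1`
    have hone : ⟪MertensKernel.kernelSection 1, hsys.vec h⟫ = (ev h)⁻¹ * φ h 1 := by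
      rw [MertensKernel.inner_kernelSection, hh.eq 1 (by simp), inv_mul_cancel_left₀ hne]
      exact MertensKernel.integral_K_mul_congr hh.memLp.coeFn_toLp 1
    have hbeq : b h = ev j * φ j 1 * ((ev h)⁻¹ * φ h 1) - MertensKernel.ip (φ j) (φ h) + a h := by
      rw [hb', hj.toLp_Q, inner_add_left, inner_sub_left, real_inner_smul_left, hone, ← ha',
        MertensKernel.IsMaximalEigensystem.vec, MertensKernel.inner_toLp]
    -- by orthonormality `⟨φ j, φ h⟩` vanishes unless `j = h`, when the eigenvalues agree
    have hip : ev h * MertensKernel.ip (φ j) (φ h) = ev j * MertensKernel.ip (φ j) (φ h) := by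
      rw [hsys.orthonormal]
      by_cases hjh : j = h
      · simp [hjh]
      · simp [hjh]
    rw [hab] at hbeq
    have hmul : (ev h + ev j) * b h
        = ev j * (φ j 1 * φ h 1) - ev h * MertensKernel.ip (φ j) (φ h) := by
      field_simp at hbeq
      linarith
    constructor
    · rw [hab]
      field_simp
    · field_simp
      linarith
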